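/- Let $T>0$ and let $\sigma_1:[0,T]\to\mathbb C$ be a function of bounded variation which is continuous from the right at every $t\in(0,T)$ and satisfies $H_1:=\sigma_1(0+)-\sigma_1(0)\neq 0$. Put $U_1(y):=\int_0^T y(t)\,d\sigma_1(t)$ (the Stieltjes integral over $[0,T]$, including the mass $H_1$ at $t=0$). For complex-valued functions $p\in AC[0,T]$ and $q\in L(0,T)$ consider the differential pencil $$y''(x)+\bigl(\lambda^2-2\lambda p(x)-q(x)\bigr)y(x)=0,\qquad x\in(0,T),\qquad (1)$$ where a solution is a function $y$ with $y'$ absolutely continuous on $[0,T]$ that satisfies (1) almost everywhere. Let $X_1(x,\lambda),X_2(x,\lambda)$ be the solutions of (1) with $X_1(0,\lambda)=X_2'(0,\lambda)=1$, $X_1'(0,\lambda)=X_2(0,\lambda)=0$. Let $L_1(p,q)$ be the boundary value problem for (1) with the conditions $U_1(y)=0$, $y(T)=0$, and $L_{11}(p,q)$ the one with the conditions $U_1(y)=0$, $y'(T)=0$. A number $\lambda\in\mathbb C$ is an eigenvalue of such a problem if (1) has a nontrivial solution that satisfies both conditions; its multiplicity is its order as a zero of the characteristic function $$\Delta_1(\lambda)=U_1(X_1)X_2(T,\lambda)-U_1(X_2)X_1(T,\lambda),\qquad\text{respectively}\qquad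 \Delta_{11}(\lambda)=U_1(X_1)X_2'(T,\lambda)-U_1(X_2)X_1'(T,\lambda).$$ Let $(p,q)$ and $(\tilde p,\tilde q)$ be two pairs with $p,\tilde p\in AC[0,T]$ and $q,\tilde q\in L(0,T)$, complex-valued, such that $\int_0^T p(x)\,dx=\int_0^T\tilde p(x)\,dx$. If $L_1(p,q)$ and $L_1(\tilde p,\tilde q)$ have the same eigenvalues with the same multiplicities, and $L_{11}(p,q)$ and $L_{11}(\tilde p,\tilde q)$ have the same eigenvalues with the same multiplicities, then $p(x)=\tilde p(x)$ for all $x\in(0,T)$ and $q(x)=\tilde q(x)$ for almost every $x\in(0,T)$. -/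

import Mathlib

open Set Filter Topology MeasureTheory

/-- `(y, z)` is a solution on `[0, T]` of the pencil equation
`y'' + (μ ^ 2 - 2 μ p(x) - q(x)) y = 0`, in the usual sense for an integrable coefficient `q`:
`y` is differentiable on `[0, T]` (one-sidedly at the end points) with derivative `z = y'`,
the function `y'` is absolutely continuous on `[0, T]`, and the equation holds almost everywhere. -/
structure PencilSolution (T : ℝ) (p q : ℝ → ℂ) (μ : ℂ) (y z : ℝ → ℂ) : Prop where
  hasDeriv : ∀ x ∈ Icc 0 T, HasDerivWithinAt y (z x) (Icc 0 T) x
  absCont : AbsolutelyContinuousOnInterval z 0 T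
  equation : ∀ᵐ x ∂(volume.restrict (Ioo 0 T)),
    HasDerivAt z (-((μ ^ 2 - 2 * μ * p x - q x) * y x)) x

/-- The solution `(y, y')` of the pencil equation with the initial data `y(0) = a`, `y'(0) = b`
(unique on `[0, T]`). -/
noncomputable def initialSolution (T : ℝ) (p q : ℝ → ℂ) (μ a b : ℂ) : (ℝ → ℂ) × (ℝ → ℂ) :=
  Classical.epsilon fun Y => PencilSolution T p q μ Y.1 Y.2 ∧ Y.1 0 = a ∧ Y.2 0 = b

/-- A function of bounded variation on `[0, T]`, viewed as a function on the ordered space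
`[0, T]`, is of bounded variation there. -/
theorem BoundedVariationOn.restrict_Icc {T : ℝ} {σ : ℝ → ℂ}
    (hσ : BoundedVariationOn σ (Icc 0 T)) :
    BoundedVariationOn ((Icc (0 : ℝ) T).domRestrict σ) univ := by
  refine ne_top_of_le_ne_top hσ ?_
  exact eVariationOn.comp_le_of_monotoneOn σ (φ := ((↑) : Icc (0 : ℝ) T → ℝ))
    (fun _ _ _ _ h => h) (fun x _ => x.2)

/-- Closed intervals of the ordered space `[0, T]` are compact. -/
instance compactIccSpace_Icc_zero (T : ℝ) : CompactIccSpace (Icc (0 : ℝ) T) :=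
  ⟨fun {_ _} => isClosed_Icc.isCompact⟩

/-- The Stieltjes integral `U(y) = ∫_0^T y(t) dσ(t)` over the closed interval `[0, T]` for a
complex-valued function `σ` of bounded variation. The measure `dσ` lives on the space `[0, T]`;
its mass at the point `0` is `σ(0+) - σ(0)`. -/
noncomputable def stieltjesForm {T : ℝ} {σ : ℝ → ℂ} (hσ : BoundedVariationOn σ (Icc 0 T))
    (y : ℝ → ℂ) : ℂ :=
  VectorMeasure.integral hσ.restrict_Icc.vectorMeasure (fun t : Icc (0 : ℝ) T => y t)
    (ContinuousLinearMap.mul ℝ ℂ)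

/-- `μ` is an eigenvalue of the pencil with the two conditions `U(y) = 0` and `V(y, y') = 0`:
there is a nontrivial solution that satisfies both. -/
def IsPencilEigenvalue (T : ℝ) (p q : ℝ → ℂ) (U : (ℝ → ℂ) → ℂ)
    (V : (ℝ → ℂ) × (ℝ → ℂ) → ℂ) (μ : ℂ) : Prop :=
  ∃ y z : ℝ → ℂ, PencilSolution T p q μ y z ∧ (∃ x ∈ Icc 0 T, y x ≠ 0) ∧
    U y = 0 ∧ V (y, z) = 0

/-- The characteristic function `Δ(μ) = det [U(X_k), V(X_k)]_{k = 1, 2}`, where `X_1`, `X_2` are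
the solutions with `X_1(0) = X_2'(0) = 1` and `X_1'(0) = X_2(0) = 0`. -/
noncomputable def characteristicFunction (T : ℝ) (p q : ℝ → ℂ) (U : (ℝ → ℂ) → ℂ)
    (V : (ℝ → ℂ) × (ℝ → ℂ) → ℂ) (μ : ℂ) : ℂ :=
  Matrix.det !![U (initialSolution T p q μ 1 0).1, V (initialSolution T p q μ 1 0);
                U (initialSolution T p q μ 0 1).1, V (initialSolution T p q μ 0 1)]

open Classical in
/-- The spectrum of the problem `U(y) = V(y, y') = 0`, counted with multiplicities, as the function
that assigns to `μ` its multiplicity: `0` if `μ` is not an eigenvalue, and the order of `μ` as a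
zero of the characteristic function if it is. -/
noncomputable def spectrumMultiplicity (T : ℝ) (p q : ℝ → ℂ) (U : (ℝ → ℂ) → ℂ)
    (V : (ℝ → ℂ) × (ℝ → ℂ) → ℂ) (μ : ℂ) : ℕ∞ :=
  if IsPencilEigenvalue T p q U V μ then
    analyticOrderAt (characteristicFunction T p q U V) μ
  else 0

/-!
Let `C(t, x)` be the Cauchy function of the pencil and put `θ(x) = ∫ C(t, x) dσ₁(t)`. Then `θ` is a
solution with `U₁(θ) = 0`, and the characteristic functions are `θ(T)` and `θ'(T)`.

For large `|λ|` the solutions behave like `exp (±i (λ x - ∫₀ˣ p))`, and the mass `H₁` dominates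
`θ`. Two characteristic functions with the same zeros have a zero-free quotient of exponential type;
since `∫ p` is prescribed, this quotient tends to `1` along `Im λ → ±∞`, so by Phragmén-Lindelöf and
Liouville it is `1`. Hence the spectra determine `θ(T)` and `θ'(T)`.

Now let `θ(a)` and `θ'(a)` be common to both pencils, `θ` being formed with `dσ₁` on `[0, a]`. For
`x ∈ [a/2, a]` the Wronskian at `a` of the Cauchy functions `C(x, ·)` of the two pencils, multiplied
by `θ(a)`, is bounded by products of values of `θ` at `x` and of `C(x, a)`, which makes the
Wronskian vanish as `Im λ → ±∞`, hence identically. So the pencils have the same quotient of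
solutions on `[a/2, a]`, which recovers `p` and `q` there. Solving back from `a` to `a/2` gives the
common data at `a/2`, and repeated halving exhausts `(0, T)`.
-/

/-! ### Absolutely continuous functions -/

theorem absolutelyContinuousOnInterval_of_dist_le {X Y : Type*} [PseudoMetricSpace X]
    [PseudoMetricSpace Y] {f : ℝ → X} {g : ℝ → Y} {a b : ℝ}
    (hf : AbsolutelyContinuousOnInterval f a b)
    (h : ∀ x ∈ uIcc a b, ∀ y ∈ uIcc a b, dist (g x) (g y) ≤ dist (f x) (f y)) :
    AbsolutelyContinuousOnInterval g a b := by
  rw [absolutelyContinuousOnInterval_iff] at hf ⊢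
  intro ε hε
  obtain ⟨δ, hδ, H⟩ := hf ε hε
  refine ⟨δ, hδ, fun E hE hlt => (Finset.sum_le_sum fun i hi => ?_).trans_lt (H E hE hlt)⟩
  exact h _ (hE.1 i hi).1 _ (hE.1 i hi).2

theorem absolutelyContinuousOnInterval_congr {X : Type*} [PseudoMetricSpace X] {f g : ℝ → X}
    {a b : ℝ} (hf : AbsolutelyContinuousOnInterval f a b) (h : EqOn f g (uIcc a b)) :
    AbsolutelyContinuousOnInterval g a b :=
  absolutelyContinuousOnInterval_of_dist_le hf fun x hx y hy => by rw [h hx, h hy]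

theorem absolutelyContinuousOnInterval_clm_comp {E F : Type*} [NormedAddCommGroup E]
    [NormedSpace ℝ E] [NormedAddCommGroup F] [NormedSpace ℝ F]
    {f : ℝ → E} {a b : ℝ} (hf : AbsolutelyContinuousOnInterval f a b)
    (L : E →L[ℝ] F) : AbsolutelyContinuousOnInterval (fun x => L (f x)) a b := by
  refine absolutelyContinuousOnInterval_of_dist_le (hf.const_smul ‖L‖) fun x _ y _ => ?_
  calc dist (L (f x)) (L (f y)) = ‖L (f x - f y)‖ := by rw [dist_eq_norm, map_sub]
    _ ≤ ‖L‖ * ‖f x - f y‖ := L.le_opNorm _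
    _ = dist (‖L‖ • f x) (‖L‖ • f y) := by
      rw [dist_eq_norm, ← smul_sub, norm_smul, norm_norm]

theorem absolutelyContinuousOnInterval_integral {E : Type*} [NormedAddCommGroup E]
    [NormedSpace ℝ E] {f : ℝ → E} {a b : ℝ} (hf : IntervalIntegrable f volume a b) :
    AbsolutelyContinuousOnInterval (fun x => ∫ s in a..x, f s) a b := by
  refine absolutelyContinuousOnInterval_of_dist_le
    (hf.norm.absolutelyContinuousOnInterval_intervalIntegral left_mem_uIcc) fun x hx y hy => ?_
  have hax := hf.mono_set (uIcc_subset_uIcc_left hx)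
  have hay := hf.mono_set (uIcc_subset_uIcc_left hy)
  rw [dist_eq_norm, Real.dist_eq, intervalIntegral.integral_interval_sub_left hax hay,
    intervalIntegral.integral_interval_sub_left hax.norm hay.norm]
  exact intervalIntegral.norm_integral_le_abs_integral_norm

/-- `f` is absolutely continuous on `[0, T]` with integrable almost everywhere derivative `f'`. -/
structure HasACDeriv (T : ℝ) (f f' : ℝ → ℂ) : Prop where
  ac : AbsolutelyContinuousOnInterval f 0 T
  int : IntervalIntegrable f' volume 0 T
  ae : ∀ᵐ x ∂(volume.restrict (Ioo 0 T)), HasDerivAt f (f' x) x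

namespace HasACDeriv

variable {T : ℝ} {f f' g g' : ℝ → ℂ}

theorem continuousOn (hT : 0 < T) (hf : HasACDeriv T f f') : ContinuousOn f (Icc 0 T) := by
  simpa only [uIcc_of_le hT.le] using hf.ac.continuousOn

theorem congr (hf : HasACDeriv T f f') (h : EqOn f g (uIcc 0 T)) : HasACDeriv T g f' := by
  refine ⟨absolutelyContinuousOnInterval_congr hf.ac h, hf.int, ?_⟩
  rcases le_total T 0 with hT | hT
  · simp [Ioo_eq_empty_of_le hT]
  · rw [uIcc_of_le hT] at h
    filter_upwards [hf.ae, self_mem_ae_restrict measurableSet_Ioo] with x hx hxm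
    exact hx.congr_of_eventuallyEq
      (mem_of_superset (Icc_mem_nhds hxm.1 hxm.2) fun y hy => (h hy).symm)

theorem of_integral (hf : IntervalIntegrable f' volume 0 T) (c : ℂ) :
    HasACDeriv T (fun x => c + ∫ s in (0 : ℝ)..x, f' s) f' := by
  refine ⟨absolutelyContinuousOnInterval_of_dist_le (absolutelyContinuousOnInterval_integral hf)
    fun x _ y _ => (dist_add_left _ _ _).le, hf, ?_⟩
  rw [ae_restrict_iff' measurableSet_Ioo]
  filter_upwards [hf.ae_hasDerivAt_integral] with x hx hxT
  exact (hx (Icc_subset_uIcc (Ioo_subset_Icc_self hxT)) 0 left_mem_uIcc).const_add c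

theorem add (hf : HasACDeriv T f f') (hg : HasACDeriv T g g') :
    HasACDeriv T (fun x => f x + g x) (fun x => f' x + g' x) :=
  ⟨hf.ac.add hg.ac, hf.int.add hg.int, by
    filter_upwards [hf.ae, hg.ae] with x h₁ h₂ using h₁.add h₂⟩

theorem sub (hf : HasACDeriv T f f') (hg : HasACDeriv T g g') :
    HasACDeriv T (fun x => f x - g x) (fun x => f' x - g' x) :=
  ⟨hf.ac.sub hg.ac, hf.int.sub hg.int, by
    filter_upwards [hf.ae, hg.ae] with x h₁ h₂ using h₁.sub h₂⟩

theorem mul (hf : HasACDeriv T f f') (hg : HasACDeriv T g g') :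
    HasACDeriv T (fun x => f x * g x) (fun x => f' x * g x + f x * g' x) :=
  ⟨hf.ac.smul hg.ac, (hf.int.mul_continuousOn hg.ac.continuousOn).add
      (hg.int.continuousOn_mul hf.ac.continuousOn), by
    filter_upwards [hf.ae, hg.ae] with x h₁ h₂ using h₁.mul h₂⟩

theorem const_mul (c : ℂ) (hf : HasACDeriv T f f') :
    HasACDeriv T (fun x => c * f x) (fun x => c * f' x) :=
  ⟨hf.ac.const_smul c, hf.int.const_mul c, by
    filter_upwards [hf.ae] with x h using h.const_mul c⟩

theorem const (c : ℂ) : HasACDeriv T (fun _ => c) (fun _ => 0) := by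
  simpa using of_integral (f' := fun _ => 0) (T := T) (by simp) c

theorem of_hasDerivWithinAt (hf : ∀ x ∈ uIcc 0 T, HasDerivWithinAt f (f' x) (uIcc 0 T) x)
    (hc : ContinuousOn f' (uIcc 0 T)) : HasACDeriv T f f' := by
  obtain ⟨C, hC⟩ := isCompact_uIcc.exists_bound_of_continuousOn hc
  have hlip : LipschitzOnWith C.toNNReal f (uIcc 0 T) :=
    (convex_uIcc 0 T).lipschitzOnWith_of_nnnorm_hasDerivWithin_le hf fun x hx => by
      rw [← NNReal.coe_le_coe, coe_nnnorm]
      exact (hC x hx).trans (Real.le_coe_toNNReal C)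
  refine ⟨hlip.absolutelyContinuousOnInterval, hc.intervalIntegrable, ?_⟩
  filter_upwards [self_mem_ae_restrict measurableSet_Ioo] with x hx
  have hsub : Icc 0 T ⊆ uIcc 0 T := Icc_subset_uIcc
  exact (hf x (hsub (Ioo_subset_Icc_self hx))).hasDerivAt
    (mem_of_superset (Icc_mem_nhds hx.1 hx.2) hsub)

theorem exists_eqOn_const (hT : 0 < T) (hf : HasACDeriv T f fun _ => 0) :
    ∃ C, ∀ x ∈ Icc 0 T, f x = C := by
  have hae := hf.ae
  rw [restrict_Ioo_eq_restrict_Icc, ← uIcc_of_le hT.le,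
    ae_restrict_iff' measurableSet_uIcc] at hae
  simpa only [uIcc_of_le hT.le] using hf.ac.const_of_ae_hasDerivAt_zero hae

theorem eq_integral (hT : 0 < T) (hf : HasACDeriv T f f') {s t : ℝ} (hs : s ∈ Icc 0 T)
    (ht : t ∈ Icc 0 T) : f t = f s + ∫ x in s..t, f' x := by
  have hzero := hf.sub (of_integral hf.int 0)
  simp only [sub_self] at hzero
  obtain ⟨C, hC⟩ := hzero.exists_eqOn_const hT
  have hint : ∀ x ∈ Icc 0 T, IntervalIntegrable f' volume 0 x := fun x hx =>
    hf.int.mono_set (uIcc_subset_uIcc_left (by rwa [uIcc_of_le hT.le]))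
  rw [← intervalIntegral.integral_interval_sub_left (hint t ht) (hint s hs)]
  linear_combination hC t ht - hC s hs

end HasACDeriv

theorem exists_hasACDeriv {T : ℝ} {f : ℝ → ℂ}
    (hf : AbsolutelyContinuousOnInterval f 0 T) : ∃ f', HasACDeriv T f f' := by
  have hre := absolutelyContinuousOnInterval_clm_comp hf Complex.reCLM
  have him := absolutelyContinuousOnInterval_clm_comp hf Complex.imCLM
  refine ⟨fun x => ((deriv (fun s => (f s).re) x : ℝ) : ℂ) +
    ((deriv (fun s => (f s).im) x : ℝ) : ℂ) * Complex.I, hf, ?_, ?_⟩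
  · have hre' := hre.intervalIntegrable_deriv
    have him' := him.intervalIntegrable_deriv
    rw [intervalIntegrable_iff] at hre' him' ⊢
    exact hre'.ofReal.add (him'.ofReal.mul_const _)
  · rw [ae_restrict_iff' measurableSet_Ioo]
    filter_upwards [hre.ae_differentiableAt, him.ae_differentiableAt] with x hr hi hx
    have hx' := Icc_subset_uIcc (Ioo_subset_Icc_self hx)
    refine ((hr hx').hasDerivAt.ofReal_comp.add
      ((hi hx').hasDerivAt.ofReal_comp.mul_const Complex.I)).congr_of_eventuallyEq
      (.of_forall fun y => ?_)
    simp [Complex.re_add_im]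

/-! ### Linear Volterra equations -/

theorem isUnit_one_add_of_norm_pow_lt_one {R : Type*} [NormedRing R] [CompleteSpace R] {a : R}
    {n : ℕ} (h : ‖a ^ n‖ < 1) : IsUnit (1 + a) := by
  have hcomm : Commute (1 - -a) (∑ i ∈ Finset.range n, (-a) ^ i) := by
    rw [commute_iff_eq, mul_neg_geom_sum, geom_sum_mul_neg]
  have hneg : ‖(-a) ^ n‖ = ‖a ^ n‖ := by
    rcases n.even_or_odd with hn | hn
    · rw [hn.neg_pow]
    · rw [hn.neg_pow, norm_neg]
  rw [← sub_neg_eq_add]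
  refine (hcomm.isUnit_mul_iff.1 ?_).1
  rw [mul_neg_geom_sum]
  exact isUnit_one_sub_of_norm_lt_one (hneg.trans_lt h)

theorem exists_differentiable_apply_eq {E : Type*} [NormedAddCommGroup E] [NormedSpace ℂ E]
    [CompleteSpace E] {S : ℂ → E →L[ℂ] E} (hS : Differentiable ℂ S) (h : ∀ μ, IsUnit (S μ))
    (f : E) : ∃ Y : ℂ → E, Differentiable ℂ Y ∧ ∀ μ, S μ (Y μ) = f :=
  ⟨fun μ => Ring.inverse (S μ) f,
    fun μ => ((hS μ).inverse (h μ)).clm_apply (differentiableAt_const f),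
    fun μ => congrArg (fun L : E →L[ℂ] E => L f) (Ring.mul_inverse_cancel _ (h μ))⟩

section PrimitiveOp

variable {T : ℝ} {hT : 0 ≤ T} {g : ℝ → ℂ}

theorem intervalIntegrable_mul_IccExtend (hg : IntervalIntegrable g volume 0 T)
    (y : C(Icc (0 : ℝ) T, ℂ)) {x : ℝ} (hx : x ∈ Icc 0 T) :
    IntervalIntegrable (fun s => g s * IccExtend hT y s) volume 0 x :=
  (hg.mul_continuousOn (y.continuous.Icc_extend' (h := hT)).continuousOn).mono_set
    (uIcc_subset_uIcc_left (by rwa [uIcc_of_le hT]))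

theorem norm_integral_mul_IccExtend_le (hg : IntervalIntegrable g volume 0 T)
    {y : C(Icc (0 : ℝ) T, ℂ)} {x M : ℝ} (hx : x ∈ Icc 0 T) (hM : 0 ≤ M)
    (hy : ∀ s : Icc (0 : ℝ) T, (s : ℝ) ≤ x → ‖y s‖ ≤ M) :
    ‖∫ s in (0 : ℝ)..x, g s * IccExtend hT y s‖ ≤ (∫ s in (0 : ℝ)..T, ‖g s‖) * M := by
  have hgx := hg.norm.mono_set (uIcc_subset_uIcc_left (by rwa [uIcc_of_le hT] : x ∈ uIcc 0 T))
  calc ‖∫ s in (0 : ℝ)..x, g s * IccExtend hT y s‖ ≤ ∫ s in (0 : ℝ)..x, ‖g s‖ * M := by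
        refine intervalIntegral.norm_integral_le_of_norm_le hx.1
          (.of_forall fun s hs => ?_) (hgx.mul_const M)
        have hs' : s ∈ Icc 0 T := ⟨hs.1.le, hs.2.trans hx.2⟩
        rw [norm_mul, IccExtend_of_mem hT _ hs']
        exact mul_le_mul_of_nonneg_left (hy ⟨s, hs'⟩ hs.2) (norm_nonneg _)
    _ = (∫ s in (0 : ℝ)..x, ‖g s‖) * M := intervalIntegral.integral_mul_const _ _
    _ ≤ (∫ s in (0 : ℝ)..T, ‖g s‖) * M :=
        mul_le_mul_of_nonneg_right (intervalIntegral.integral_mono_interval le_rfl hx.1 hx.2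
          (.of_forall fun _ => norm_nonneg _) hg.norm) hM

/-- The operator `y ↦ ∫_0^x g y` on `C([0, T])`. -/
noncomputable def primitiveOp (hT : 0 ≤ T) (g : ℝ → ℂ) (hg : IntervalIntegrable g volume 0 T) :
    C(Icc (0 : ℝ) T, ℂ) →L[ℂ] C(Icc (0 : ℝ) T, ℂ) :=
  LinearMap.mkContinuous
    { toFun := fun y =>
        { toFun := fun x => ∫ s in (0 : ℝ)..x, g s * IccExtend hT y s
          continuous_toFun := by
            have h := intervalIntegral.continuousOn_primitive_interval'
              (intervalIntegrable_mul_IccExtend (hT := hT) hg y ⟨hT, le_rfl⟩) left_mem_uIcc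
            rw [uIcc_of_le hT] at h
            exact continuousOn_iff_continuous_domRestrict.1 h }
      map_add' := fun y z => ContinuousMap.ext fun x =>
        (intervalIntegral.integral_congr fun s _ => mul_add _ _ _).trans
          (intervalIntegral.integral_add (intervalIntegrable_mul_IccExtend hg y x.2)
            (intervalIntegrable_mul_IccExtend hg z x.2))
      map_smul' := fun c y => ContinuousMap.ext fun x =>
        (intervalIntegral.integral_congr fun s _ => mul_left_comm _ c _).trans
          (intervalIntegral.integral_const_mul c fun s => g s * IccExtend hT y s) }
    (∫ s in (0 : ℝ)..T, ‖g s‖) fun y => by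
      have hG : 0 ≤ ∫ s in (0 : ℝ)..T, ‖g s‖ :=
        intervalIntegral.integral_nonneg hT fun _ _ => norm_nonneg _
      exact (ContinuousMap.norm_le _ (by positivity)).2 fun x =>
        norm_integral_mul_IccExtend_le hg x.2 (norm_nonneg y) fun s _ => y.norm_coe_le_norm s

theorem primitiveOp_apply (hg : IntervalIntegrable g volume 0 T) (y : C(Icc (0 : ℝ) T, ℂ))
    (x : Icc (0 : ℝ) T) :
    primitiveOp hT g hg y x = ∫ s in (0 : ℝ)..x, g s * IccExtend hT y s := rfl

theorem norm_primitiveOp_mul_pow_apply_le (hg : IntervalIntegrable g volume 0 T) (n : ℕ)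
    (y : C(Icc (0 : ℝ) T, ℂ)) (x : Icc (0 : ℝ) T) :
    ‖((primitiveOp hT (fun _ => 1) (by simp) * primitiveOp hT g hg) ^ n) y x‖ ≤
      ((∫ s in (0 : ℝ)..T, ‖g s‖) * x) ^ n / n.factorial * ‖y‖ := by
  set G := ∫ s in (0 : ℝ)..T, ‖g s‖
  have hG : 0 ≤ G := intervalIntegral.integral_nonneg hT fun _ _ => norm_nonneg _
  induction n generalizing x with
  | zero => simpa using y.norm_coe_le_norm x
  | succ n ih =>
    set w := ((primitiveOp hT (fun _ => 1) (by simp) * primitiveOp hT g hg) ^ n) y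
    have hinner : ∀ s ∈ Ioc 0 (x : ℝ), ‖1 * IccExtend hT (primitiveOp hT g hg w) s‖ ≤
        G ^ (n + 1) / n.factorial * ‖y‖ * s ^ n := fun s hs => by
      have hs' : s ∈ Icc 0 T := ⟨hs.1.le, hs.2.trans x.2.2⟩
      rw [one_mul, IccExtend_of_mem hT _ hs', primitiveOp_apply]
      refine (norm_integral_mul_IccExtend_le hg hs'
        (M := (G * s) ^ n / n.factorial * ‖y‖) ?_ fun r hr => (ih r).trans ?_).trans_eq ?_
      · have := hs'.1; positivity
      · have := r.2.1; gcongr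
      · ring
    rw [pow_succ']
    change ‖∫ s in (0 : ℝ)..x, 1 * IccExtend hT (primitiveOp hT g hg w) s‖ ≤ _
    refine (intervalIntegral.norm_integral_le_of_norm_le x.2.1 (.of_forall hinner)
      (Continuous.intervalIntegrable (by fun_prop) _ _)).trans_eq ?_
    rw [intervalIntegral.integral_const_mul, integral_pow, Nat.factorial_succ, zero_pow (by simp)]
    push_cast
    field_simp
    ring

theorem isUnit_one_add_primitiveOp_mul (hg : IntervalIntegrable g volume 0 T) :
    IsUnit (1 + primitiveOp hT (fun _ => 1) (by simp) * primitiveOp hT g hg) := by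
  set A := primitiveOp hT (fun _ => 1) (by simp) * primitiveOp hT g hg
  set G := ∫ s in (0 : ℝ)..T, ‖g s‖
  have hG : 0 ≤ G := intervalIntegral.integral_nonneg hT fun _ _ => norm_nonneg _
  have hbound : ∀ n, ‖A ^ n‖ ≤ (G * T) ^ n / n.factorial := fun n =>
    ContinuousLinearMap.opNorm_le_bound _ (by positivity) fun y =>
      (ContinuousMap.norm_le _ (by positivity)).2 fun x =>
        (norm_primitiveOp_mul_pow_apply_le hg n y x).trans (by
          have := x.2.1
          have := x.2.2
          gcongr)
  obtain ⟨n, hn⟩ :=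
    ((FloorSemiring.tendsto_pow_div_factorial_atTop (G * T)).eventually_lt_const one_pos).exists
  exact isUnit_one_add_of_norm_pow_lt_one
    (R := C(Icc (0 : ℝ) T, ℂ) →L[ℂ] C(Icc (0 : ℝ) T, ℂ)) ((hbound n).trans_lt hn)

end PrimitiveOp

/-- The coefficient `μ² - 2 μ p - q` of the pencil equation `y'' + (μ² - 2 μ p - q) y = 0`. -/
def pencilCoeff (p q : ℝ → ℂ) (μ : ℂ) (x : ℝ) : ℂ := μ ^ 2 - 2 * μ * p x - q x

section Existence

variable {T : ℝ} {p q : ℝ → ℂ} {μ a b : ℂ}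

theorem intervalIntegrable_pencilCoeff (hp : IntervalIntegrable p volume 0 T)
    (hq : IntervalIntegrable q volume 0 T) (μ : ℂ) :
    IntervalIntegrable (pencilCoeff p q μ) volume 0 T :=
  (intervalIntegrable_const.sub (hp.const_mul _)).sub hq

theorem primitiveOp_pencilCoeff (hT : 0 ≤ T) (hp : IntervalIntegrable p volume 0 T)
    (hq : IntervalIntegrable q volume 0 T) (μ : ℂ) :
    primitiveOp hT (pencilCoeff p q μ) (intervalIntegrable_pencilCoeff hp hq μ) =
      μ ^ 2 • primitiveOp hT (fun _ => 1) (by simp) - (2 * μ) • primitiveOp hT p hp -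
        primitiveOp hT q hq := by
  ext y x
  have hone := (intervalIntegrable_mul_IccExtend (hT := hT) (g := fun _ => 1) (by simp) y
    x.2).const_mul (μ ^ 2)
  have hpy := (intervalIntegrable_mul_IccExtend (hT := hT) hp y x.2).const_mul (2 * μ)
  have hqy := intervalIntegrable_mul_IccExtend (hT := hT) hq y x.2
  change _ = μ ^ 2 * (∫ s in (0 : ℝ)..x, 1 * IccExtend hT y s) -
    (2 * μ) * (∫ s in (0 : ℝ)..x, p s * IccExtend hT y s) -
    ∫ s in (0 : ℝ)..x, q s * IccExtend hT y s
  rw [← intervalIntegral.integral_const_mul, ← intervalIntegral.integral_const_mul,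
    ← intervalIntegral.integral_sub hone hpy, ← intervalIntegral.integral_sub (hone.sub hpy) hqy]
  exact intervalIntegral.integral_congr fun s _ => by simp only [pencilCoeff]; ring

theorem differentiable_quadratic_sub_linear_sub_const {E F : Type*} [NormedAddCommGroup E]
    [NormedSpace ℂ E] [NormedAddCommGroup F] [NormedSpace ℂ F] (A B C : E →L[ℂ] F) :
    Differentiable ℂ fun μ : ℂ => μ ^ 2 • A - (2 * μ) • B - C := by
  fun_prop

theorem differentiable_primitiveOp_pencilCoeff (hT : 0 ≤ T) (hp : IntervalIntegrable p volume 0 T)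
    (hq : IntervalIntegrable q volume 0 T) :
    Differentiable ℂ fun μ =>
      primitiveOp hT (pencilCoeff p q μ) (intervalIntegrable_pencilCoeff hp hq μ) := by
  rw [funext (primitiveOp_pencilCoeff hT hp hq)]
  exact differentiable_quadratic_sub_linear_sub_const _ _ _

theorem PencilSolution.of_integral_eq {y z : ℝ → ℂ} (hp : IntervalIntegrable p volume 0 T)
    (hq : IntervalIntegrable q volume 0 T) (hyc : Continuous y) (hzc : Continuous z)
    (hy : ∀ x ∈ Icc 0 T, y x = a + ∫ s in (0 : ℝ)..x, z s)
    (hz : ∀ x ∈ uIcc 0 T, z x = b - ∫ s in (0 : ℝ)..x, pencilCoeff p q μ s * y s) :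
    PencilSolution T p q μ y z := by
  have hint := ((intervalIntegrable_pencilCoeff hp hq μ).mul_continuousOn hyc.continuousOn).neg
  have hac : HasACDeriv T z fun s => -(pencilCoeff p q μ s * y s) :=
    (HasACDeriv.of_integral hint b).congr fun x hx => by
      rw [hz x hx, sub_eq_add_neg, ← intervalIntegral.integral_neg]
      rfl
  refine ⟨fun x hx => ?_, hac.ac, hac.ae⟩
  have hprim : HasDerivAt (fun x => a + ∫ s in (0 : ℝ)..x, z s) (z x) x :=
    (intervalIntegral.integral_hasDerivAt_right (hzc.intervalIntegrable _ _)
      (hzc.stronglyMeasurableAtFilter _ _) hzc.continuousAt).const_add a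
  exact hprim.hasDerivWithinAt.congr hy (hy x hx)

theorem PencilSolution.of_primitiveOp (hT : 0 ≤ T) (hp : IntervalIntegrable p volume 0 T)
    (hq : IntervalIntegrable q volume 0 T) {Y Z : C(Icc (0 : ℝ) T, ℂ)}
    (hY : ∀ x, Y x = a + primitiveOp hT (fun _ => 1) (by simp) Z x)
    (hZ : ∀ x, Z x = b -
      primitiveOp hT (pencilCoeff p q μ) (intervalIntegrable_pencilCoeff hp hq μ) Y x) :
    PencilSolution T p q μ (IccExtend hT Y) (IccExtend hT Z) ∧
      IccExtend hT Y 0 = a ∧ IccExtend hT Z 0 = b := by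
  have hy : ∀ x ∈ Icc 0 T, IccExtend hT Y x = a + ∫ s in (0 : ℝ)..x, IccExtend hT Z s :=
    fun x hx => by
      rw [IccExtend_of_mem hT _ hx, hY, primitiveOp_apply]
      simp only [one_mul]
  have hz : ∀ x ∈ Icc 0 T, IccExtend hT Z x =
      b - ∫ s in (0 : ℝ)..x, pencilCoeff p q μ s * IccExtend hT Y s := fun x hx => by
    rw [IccExtend_of_mem hT _ hx, hZ, primitiveOp_apply]
  refine ⟨.of_integral_eq hp hq Y.continuous.Icc_extend' Z.continuous.Icc_extend' hy
    (by rwa [uIcc_of_le hT]), by simpa using hy 0 ⟨le_rfl, hT⟩, by simpa using hz 0 ⟨le_rfl, hT⟩⟩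

theorem exists_pencilSolution_family (hT : 0 ≤ T) (hp : IntervalIntegrable p volume 0 T)
    (hq : IntervalIntegrable q volume 0 T) (a b : ℂ) :
    ∃ Y Z : ℂ → C(Icc (0 : ℝ) T, ℂ), Differentiable ℂ Y ∧ Differentiable ℂ Z ∧ ∀ μ,
      PencilSolution T p q μ (IccExtend hT (Y μ)) (IccExtend hT (Z μ)) ∧
      IccExtend hT (Y μ) 0 = a ∧ IccExtend hT (Z μ) 0 = b := by
  set J := primitiveOp hT (fun _ => 1) (by simp)
  set P := fun μ => primitiveOp hT (pencilCoeff p q μ) (intervalIntegrable_pencilCoeff hp hq μ)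
  have hP : Differentiable ℂ P := differentiable_primitiveOp_pencilCoeff hT hp hq
  -- Eliminating `Z = b - P Y` from the integral equations `Y = a + J Z` leaves `(1 + J P) Y = f`.
  have hS : Differentiable ℂ fun μ => 1 + J * P μ :=
    ((differentiable_const J).clm_comp hP).const_add 1
  obtain ⟨Y, hY, hYeq⟩ :=
    exists_differentiable_apply_eq hS (fun _ => isUnit_one_add_primitiveOp_mul _)
    (ContinuousMap.const _ a + J (.const _ b))
  refine ⟨Y, fun μ => .const _ b - P μ (Y μ), hY, (hP.clm_apply hY).const_sub _, fun μ =>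
    PencilSolution.of_primitiveOp hT hp hq (fun x => ?_) fun x => rfl⟩
  have h : Y μ x + J (P μ (Y μ)) x = a + J (.const _ b) x := DFunLike.congr_fun (hYeq μ) x
  change Y μ x = a + J (.const _ b - P μ (Y μ)) x
  rw [map_sub, ContinuousMap.sub_apply]
  linear_combination h

end Existence

namespace PencilSolution

variable {T : ℝ} {p q p' q' : ℝ → ℂ} {μ : ℂ} {y z y' z' : ℝ → ℂ}

theorem continuousOn_deriv (hT : 0 < T) (h : PencilSolution T p q μ y z) :
    ContinuousOn z (Icc 0 T) := by
  simpa only [uIcc_of_le hT.le] using h.absCont.continuousOn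

theorem continuousOn (h : PencilSolution T p q μ y z) : ContinuousOn y (Icc 0 T) := fun x hx =>
  (h.hasDeriv x hx).continuousWithinAt

theorem hasACDeriv (hT : 0 < T) (h : PencilSolution T p q μ y z) : HasACDeriv T y z :=
  .of_hasDerivWithinAt (by simpa only [uIcc_of_le hT.le] using h.hasDeriv) h.absCont.continuousOn

theorem hasACDeriv_deriv (hT : 0 < T) (hp : IntervalIntegrable p volume 0 T)
    (hq : IntervalIntegrable q volume 0 T) (h : PencilSolution T p q μ y z) :
    HasACDeriv T z (fun x => -(pencilCoeff p q μ x * y x)) := by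
  refine ⟨h.absCont, ((intervalIntegrable_pencilCoeff hp hq μ).mul_continuousOn ?_).neg, h.equation⟩
  rw [uIcc_of_le hT.le]
  exact h.continuousOn

theorem combination (h : PencilSolution T p q μ y z) (h' : PencilSolution T p q μ y' z')
    (c d : ℂ) :
    PencilSolution T p q μ (fun x => c * y x + d * y' x) (fun x => c * z x + d * z' x) := by
  refine ⟨fun x hx => ((h.hasDeriv x hx).const_mul c).add ((h'.hasDeriv x hx).const_mul d),
    (h.absCont.const_smul c).add (h'.absCont.const_smul d), ?_⟩
  filter_upwards [h.equation, h'.equation] with x hx hx'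
  exact ((hx.const_mul c).add (hx'.const_mul d)).congr_deriv (by ring)

theorem wronskian_eq_of_ae_eq (hT : 0 < T) {a : ℝ} (ha : 0 ≤ a)
    (hp : IntervalIntegrable p volume 0 T) (hq : IntervalIntegrable q volume 0 T)
    (hp' : IntervalIntegrable p' volume 0 T) (hq' : IntervalIntegrable q' volume 0 T)
    (h : PencilSolution T p q μ y z) (h' : PencilSolution T p' q' μ y' z')
    (hpp : ∀ᵐ x ∂(volume.restrict (Ioo a T)), p x = p' x)
    (hqq : ∀ᵐ x ∂(volume.restrict (Ioo a T)), q x = q' x) {s t : ℝ} (hs : s ∈ Icc a T)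
    (ht : t ∈ Icc a T) :
    y s * z' s - z s * y' s = y t * z' t - z t * y' t := by
  have hW := ((h.hasACDeriv hT).mul (h'.hasACDeriv_deriv hT hp' hq')).sub
    ((h.hasACDeriv_deriv hT hp hq).mul (h'.hasACDeriv hT))
  have hsub : Icc a T ⊆ Icc 0 T := Icc_subset_Icc_left ha
  rw [hW.eq_integral hT (hsub ht) (hsub hs), intervalIntegral.integral_zero_ae, add_zero]
  rw [restrict_Ioo_eq_restrict_Icc, ae_restrict_iff' measurableSet_Icc] at hpp hqq
  filter_upwards [hpp, hqq] with x hpx hqx hx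
  have hxa : x ∈ Icc a T := uIcc_subset_Icc ht hs (uIoc_subset_uIcc hx)
  simp only [pencilCoeff, hpx hxa, hqx hxa]
  ring

theorem wronskian_eq (hT : 0 < T) (hp : IntervalIntegrable p volume 0 T)
    (hq : IntervalIntegrable q volume 0 T) (h : PencilSolution T p q μ y z)
    (h' : PencilSolution T p q μ y' z') {s t : ℝ} (hs : s ∈ Icc 0 T) (ht : t ∈ Icc 0 T) :
    y s * z' s - z s * y' s = y t * z' t - z t * y' t :=
  wronskian_eq_of_ae_eq hT le_rfl hp hq hp hq h h' (.of_forall fun _ => rfl)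
    (.of_forall fun _ => rfl) hs ht

end PencilSolution

section InitialSolution

variable {T : ℝ} {p q : ℝ → ℂ} {μ : ℂ} {y z y' z' : ℝ → ℂ}

theorem initialSolution_spec (hT : 0 ≤ T) (hp : IntervalIntegrable p volume 0 T)
    (hq : IntervalIntegrable q volume 0 T) (μ a b : ℂ) :
    PencilSolution T p q μ (initialSolution T p q μ a b).1 (initialSolution T p q μ a b).2 ∧
      (initialSolution T p q μ a b).1 0 = a ∧ (initialSolution T p q μ a b).2 0 = b := by
  obtain ⟨Y, Z, -, -, h⟩ := exists_pencilSolution_family hT hp hq a b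
  exact Classical.epsilon_spec (p := fun Y : (ℝ → ℂ) × (ℝ → ℂ) =>
    PencilSolution T p q μ Y.1 Y.2 ∧ Y.1 0 = a ∧ Y.2 0 = b) ⟨(_, _), h μ⟩

theorem PencilSolution.eq_fundamental (hT : 0 < T) (hp : IntervalIntegrable p volume 0 T)
    (hq : IntervalIntegrable q volume 0 T) (h : PencilSolution T p q μ y z) {x : ℝ}
    (hx : x ∈ Icc 0 T) :
    y x = y 0 * (initialSolution T p q μ 1 0).1 x + z 0 * (initialSolution T p q μ 0 1).1 x ∧
    z x = y 0 * (initialSolution T p q μ 1 0).2 x + z 0 * (initialSolution T p q μ 0 1).2 x := by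
  obtain ⟨hX₁, h₁, h₁'⟩ := initialSolution_spec hT.le hp hq μ 1 0
  obtain ⟨hX₂, h₂, h₂'⟩ := initialSolution_spec hT.le hp hq μ 0 1
  have h0 : (0 : ℝ) ∈ Icc 0 T := ⟨le_rfl, hT.le⟩
  have hw₁₂ := hX₁.wronskian_eq hT hp hq hX₂ hx h0
  have hw₁ := h.wronskian_eq hT hp hq hX₁ hx h0
  have hw₂ := h.wronskian_eq hT hp hq hX₂ hx h0
  rw [h₁, h₁', h₂, h₂'] at hw₁₂
  rw [h₁, h₁'] at hw₁
  rw [h₂, h₂'] at hw₂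
  constructor
  · linear_combination (-(y x)) * hw₁₂ + (initialSolution T p q μ 1 0).1 x * hw₂ -
      (initialSolution T p q μ 0 1).1 x * hw₁
  · linear_combination (-(z x)) * hw₁₂ + (initialSolution T p q μ 1 0).2 x * hw₂ -
      (initialSolution T p q μ 0 1).2 x * hw₁

theorem PencilSolution.eqOn (hT : 0 < T) (hp : IntervalIntegrable p volume 0 T)
    (hq : IntervalIntegrable q volume 0 T) (h : PencilSolution T p q μ y z)
    (h' : PencilSolution T p q μ y' z') (hy : y 0 = y' 0) (hz : z 0 = z' 0) :
    EqOn y y' (Icc 0 T) ∧ EqOn z z' (Icc 0 T) := by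
  constructor <;> intro x hx
  · rw [(h.eq_fundamental hT hp hq hx).1, (h'.eq_fundamental hT hp hq hx).1, hy, hz]
  · rw [(h.eq_fundamental hT hp hq hx).2, (h'.eq_fundamental hT hp hq hx).2, hy, hz]

theorem exists_initialSolution_family (hT : 0 < T) (hp : IntervalIntegrable p volume 0 T)
    (hq : IntervalIntegrable q volume 0 T) (a b : ℂ) :
    ∃ Y Z : ℂ → C(Icc (0 : ℝ) T, ℂ), Differentiable ℂ Y ∧ Differentiable ℂ Z ∧
      ∀ μ, ∀ x : Icc (0 : ℝ) T, (initialSolution T p q μ a b).1 x = Y μ x ∧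
        (initialSolution T p q μ a b).2 x = Z μ x := by
  obtain ⟨Y, Z, hY, hZ, h⟩ := exists_pencilSolution_family hT.le hp hq a b
  refine ⟨Y, Z, hY, hZ, fun μ x => ?_⟩
  obtain ⟨hX, hXa, hXb⟩ := initialSolution_spec hT.le hp hq μ a b
  obtain ⟨hYZ, hYa, hZb⟩ := h μ
  have heq := hX.eqOn hT hp hq hYZ (hXa.trans hYa.symm) (hXb.trans hZb.symm)
  exact ⟨(heq.1 x.2).trans (IccExtend_val _ _ x), (heq.2 x.2).trans (IccExtend_val _ _ x)⟩

end InitialSolution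

/-! ### Estimates for large `μ` -/

/-- The phase `Φ(x) = μ x - ∫₀ˣ p` of the pencil equation, whose solutions behave like
combinations of `exp (± i Φ)` for large `μ`. -/
noncomputable def pencilPhase (p : ℝ → ℂ) (μ : ℂ) (x : ℝ) : ℂ := μ * x - ∫ s in (0 : ℝ)..x, p s

section Phase

variable {T : ℝ} {p p' q : ℝ → ℂ} {μ ε : ℂ}

theorem pencilPhase_zero : pencilPhase p μ 0 = 0 := by simp [pencilPhase]

theorem pencilPhase_sub (hp : IntervalIntegrable p volume 0 T) {s x : ℝ} (hs : s ∈ Icc 0 T)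
    (hx : x ∈ Icc 0 T) :
    pencilPhase p μ x - pencilPhase p μ s = μ * (x - s : ℝ) - ∫ u in s..x, p u := by
  have hint : ∀ u ∈ Icc 0 T, IntervalIntegrable p volume 0 u := fun u hu =>
    hp.mono_set (uIcc_subset_uIcc_left (Icc_subset_uIcc hu))
  rw [← intervalIntegral.integral_interval_sub_left (hint x hx) (hint s hs)]
  simp only [pencilPhase]
  push_cast
  ring

theorem hasDerivWithinAt_pencilPhase (hp : ContinuousOn p (Icc 0 T)) {x : ℝ} (hx : x ∈ Icc 0 T) :
    HasDerivWithinAt (pencilPhase p μ) (μ - p x) (Icc 0 T) x := by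
  have hlin : HasDerivWithinAt (fun x : ℝ => μ * (x : ℂ)) μ (Icc 0 T) x := by
    simpa using ((hasDerivAt_id x).ofReal_comp.const_mul μ).hasDerivWithinAt
  have hint : IntervalIntegrable p volume 0 x := ContinuousOn.intervalIntegrable <| by
    rw [uIcc_of_le hx.1]
    exact hp.mono (Icc_subset_Icc_right hx.2)
  have : Fact (x ∈ Icc 0 T) := ⟨hx⟩
  exact hlin.sub (intervalIntegral.integral_hasDerivWithinAt_right hint
    (hp.stronglyMeasurableAtFilter_nhdsWithin measurableSet_Icc x) (hp x hx))

theorem hasACDeriv_exp_pencilPhase (hT : 0 ≤ T) (hp : ContinuousOn p (Icc 0 T)) (μ ε : ℂ) :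
    HasACDeriv T (fun x => Complex.exp (ε * pencilPhase p μ x))
      (fun x => Complex.exp (ε * pencilPhase p μ x) * (ε * (μ - p x))) := by
  have hΦ : ContinuousOn (pencilPhase p μ) (Icc 0 T) := fun x hx =>
    (hasDerivWithinAt_pencilPhase hp hx).continuousWithinAt
  refine .of_hasDerivWithinAt (fun x hx => ?_) ?_ <;> simp only [uIcc_of_le hT] at *
  · exact ((hasDerivWithinAt_pencilPhase hp hx).const_mul ε).cexp
  · fun_prop

theorem norm_exp_pencilPhase_le (hp : IntervalIntegrable p volume 0 T)
    (hε : ε = Complex.I ∨ ε = -Complex.I) (μ : ℂ) {s x : ℝ} (hs : 0 ≤ s) (hsx : s ≤ x)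
    (hx : x ≤ T) :
    ‖Complex.exp (ε * (pencilPhase p μ x - pencilPhase p μ s))‖ ≤
      Real.exp (∫ u in (0 : ℝ)..T, ‖p u‖) * Real.exp ((ε * μ).re * (x - s)) := by
  have hnorm : ‖ε‖ = 1 := by rcases hε with rfl | rfl <;> simp
  have hint : ‖∫ u in s..x, p u‖ ≤ ∫ u in (0 : ℝ)..T, ‖p u‖ :=
    (intervalIntegral.norm_integral_le_integral_norm hsx).trans
      (intervalIntegral.integral_mono_interval hs hsx hx (.of_forall fun _ => norm_nonneg _)
        hp.norm)
  have hre : -(ε * ∫ u in s..x, p u).re ≤ ‖∫ u in s..x, p u‖ :=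
    calc _ ≤ ‖ε * ∫ u in s..x, p u‖ := (neg_le_abs _).trans (Complex.abs_re_le_norm _)
      _ = _ := by rw [norm_mul, hnorm, one_mul]
  rw [Complex.norm_exp, ← Real.exp_add, Real.exp_le_exp,
    pencilPhase_sub hp ⟨hs, hsx.trans hx⟩ ⟨hs.trans hsx, hx⟩, mul_sub, Complex.sub_re,
    ← mul_assoc, Complex.re_mul_ofReal]
  linarith

theorem norm_exp_pencilPhase_le_exp_abs_im (hp : IntervalIntegrable p volume 0 T)
    (hε : ε = Complex.I ∨ ε = -Complex.I) (μ : ℂ) {s x : ℝ} (hs : 0 ≤ s) (hsx : s ≤ x)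
    (hx : x ≤ T) :
    ‖Complex.exp (ε * (pencilPhase p μ x - pencilPhase p μ s))‖ ≤
      Real.exp (∫ u in (0 : ℝ)..T, ‖p u‖) * Real.exp (|μ.im| * (x - s)) := by
  have hre : (ε * μ).re ≤ |μ.im| := by
    rcases hε with rfl | rfl
    · simpa using neg_le_abs μ.im
    · simpa using le_abs_self μ.im
  refine (norm_exp_pencilPhase_le hp hε μ hs hsx hx).trans ?_
  have := sub_nonneg.2 hsx
  gcongr

theorem norm_exp_I_mul_pencilPhase_le (hp : IntervalIntegrable p volume 0 T) (μ : ℂ) {x : ℝ}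
    (hx : x ∈ Icc 0 T) :
    ‖Complex.exp (Complex.I * pencilPhase p μ x)‖ ≤
      Real.exp (∫ u in (0 : ℝ)..T, ‖p u‖) * Real.exp (-(x * μ.im)) := by
  simpa [pencilPhase_zero, mul_comm x] using
    norm_exp_pencilPhase_le hp (.inl rfl) μ le_rfl hx.1 hx.2

-- The combinations `y' ± i (μ - p) y` diagonalize the pencil equation up to an integrable
-- remainder that is free of `μ`; this is where the absolute continuity of `p` enters.
theorem PencilSolution.variation_of_constants (hT : 0 < T) (hp : HasACDeriv T p p')
    (hq : IntervalIntegrable q volume 0 T) {y z : ℝ → ℂ} (h : PencilSolution T p q μ y z)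
    (hε : ε * ε = -1) {t x : ℝ} (ht : t ∈ Icc 0 T) (hx : x ∈ Icc 0 T) :
    z x + ε * (μ - p x) * y x =
      (z t + ε * (μ - p t) * y t) * Complex.exp (ε * (pencilPhase p μ x - pencilPhase p μ t)) +
      ∫ s in t..x, Complex.exp (ε * (pencilPhase p μ x - pencilPhase p μ s)) *
        ((p s ^ 2 + q s - ε * p' s) * y s) := by
  have hpi : IntervalIntegrable p volume 0 T := hp.ac.continuousOn.intervalIntegrable
  have hρ : HasACDeriv T (fun x => μ - p x) (fun x => 0 - p' x) := (HasACDeriv.const μ).sub hp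
  have hcomb := (h.hasACDeriv_deriv hT hpi hq).add ((hρ.mul (h.hasACDeriv hT)).const_mul ε)
  have hexp := hasACDeriv_exp_pencilPhase hT.le (hp.continuousOn hT) μ (-ε)
  have hvar : (z x + ε * (μ - p x) * y x) * Complex.exp (-ε * pencilPhase p μ x) =
      (z t + ε * (μ - p t) * y t) * Complex.exp (-ε * pencilPhase p μ t) +
      ∫ s in t..x, Complex.exp (-ε * pencilPhase p μ s) *
        ((p s ^ 2 + q s - ε * p' s) * y s) := by
    rw [mul_assoc ε, mul_assoc ε, (hcomb.mul hexp).eq_integral hT ht hx]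
    congr 1
    refine intervalIntegral.integral_congr fun s _ => ?_
    simp only [pencilCoeff]
    linear_combination (-Complex.exp (-ε * pencilPhase p μ s) * (μ - p s) ^ 2 * y s) * hε
  have hsplit : ∀ s, Complex.exp (ε * (pencilPhase p μ x - pencilPhase p μ s)) =
      Complex.exp (ε * pencilPhase p μ x) * Complex.exp (-ε * pencilPhase p μ s) := fun s => by
    rw [← Complex.exp_add]
    ring_nf
  have hinv : Complex.exp (ε * pencilPhase p μ x) * Complex.exp (-ε * pencilPhase p μ x) = 1 := by
    rw [← hsplit, sub_self, mul_zero, Complex.exp_zero]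
  simp only [hsplit, mul_assoc]
  rw [intervalIntegral.integral_const_mul]
  linear_combination Complex.exp (ε * pencilPhase p μ x) * hvar -
    (z x + ε * (μ - p x) * y x) * hinv

theorem norm_sq_add_sub_mul_le (hε : ε = Complex.I ∨ ε = -Complex.I) (a b c : ℂ) :
    ‖a ^ 2 + b - ε * c‖ ≤ ‖a‖ ^ 2 + ‖b‖ + ‖c‖ := by
  have hnorm : ‖ε‖ = 1 := by rcases hε with rfl | rfl <;> simp
  calc _ ≤ ‖a ^ 2‖ + ‖b‖ + ‖ε * c‖ :=
        (norm_sub_le _ _).trans (by gcongr; exact norm_add_le _ _)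
    _ = _ := by rw [norm_pow, norm_mul, hnorm, one_mul]

theorem exists_norm_integral_remainder_le (hT : 0 ≤ T) (hp : HasACDeriv T p p')
    (hq : IntervalIntegrable q volume 0 T) :
    ∃ R : ℝ, 0 ≤ R ∧ ∀ μ ε : ℂ, (ε = Complex.I ∨ ε = -Complex.I) → ∀ t ∈ Icc 0 T, ∀ x ∈ Icc t T,
      ∀ (y : ℝ → ℂ) (M : ℝ), (∀ s ∈ Icc t x, ‖y s‖ ≤ M * Real.exp (|μ.im| * (s - t))) →
      ‖∫ s in t..x, Complex.exp (ε * (pencilPhase p μ x - pencilPhase p μ s)) *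
        ((p s ^ 2 + q s - ε * p' s) * y s)‖ ≤ R * M * Real.exp (|μ.im| * (x - t)) := by
  have hpi : IntervalIntegrable p volume 0 T := hp.ac.continuousOn.intervalIntegrable
  set K := Real.exp (∫ u in (0 : ℝ)..T, ‖p u‖)
  set m : ℝ → ℝ := fun s => ‖p s‖ ^ 2 + ‖q s‖ + ‖p' s‖
  have hm : ∀ s, 0 ≤ m s := fun s => by positivity
  have hmi : IntervalIntegrable m volume 0 T :=
    ((hp.ac.continuousOn.norm.pow 2).intervalIntegrable.add hq.norm).add hp.int.norm
  refine ⟨K * ∫ s in (0 : ℝ)..T, m s, mul_nonneg (Real.exp_nonneg _)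
    (intervalIntegral.integral_nonneg hT fun s _ => hm s), fun μ ε hε t ht x hx y M hy => ?_⟩
  have hM : 0 ≤ M := by simpa using (norm_nonneg _).trans (hy t ⟨le_rfl, hx.1⟩)
  have hbound : ∀ s ∈ Icc t x, ‖Complex.exp (ε * (pencilPhase p μ x - pencilPhase p μ s)) *
      ((p s ^ 2 + q s - ε * p' s) * y s)‖ ≤ K * M * Real.exp (|μ.im| * (x - t)) * m s := by
    intro s hs
    rw [norm_mul, norm_mul]
    calc _ ≤ K * Real.exp (|μ.im| * (x - s)) * (m s * (M * Real.exp (|μ.im| * (s - t)))) := by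
          gcongr
          · exact norm_exp_pencilPhase_le_exp_abs_im hpi hε μ (ht.1.trans hs.1) hs.2 hx.2
          · exact norm_sq_add_sub_mul_le hε _ _ _
          · exact hy s hs
      _ = K * M * (Real.exp (|μ.im| * (x - s)) * Real.exp (|μ.im| * (s - t))) * m s := by ring
      _ = _ := by rw [← Real.exp_add]; ring_nf
  have hmx : IntervalIntegrable m volume t x :=
    hmi.mono_set (uIcc_subset_uIcc (Icc_subset_uIcc ht)
      (Icc_subset_uIcc ⟨ht.1.trans hx.1, hx.2⟩))
  calc _ ≤ ∫ s in t..x, K * M * Real.exp (|μ.im| * (x - t)) * m s :=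
        intervalIntegral.norm_integral_le_of_norm_le hx.1
          (.of_forall fun s hs => hbound s (Ioc_subset_Icc_self hs)) (hmx.const_mul _)
    _ = K * M * Real.exp (|μ.im| * (x - t)) * ∫ s in t..x, m s :=
        intervalIntegral.integral_const_mul _ _
    _ ≤ K * M * Real.exp (|μ.im| * (x - t)) * ∫ s in (0 : ℝ)..T, m s := by
        gcongr
        exact intervalIntegral.integral_mono_interval ht.1 hx.1 hx.2 (.of_forall fun _ => hm _) hmi
    _ = _ := by ring

theorem norm_le_of_norm_add_I_mul_le {u v : ℂ} {B : ℝ}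
    (h : ∀ ε : ℂ, ε = Complex.I ∨ ε = -Complex.I → ‖u + ε * v‖ ≤ B) : ‖u‖ ≤ B ∧ ‖v‖ ≤ B := by
  have hplus := h _ (.inl rfl)
  have hminus := h _ (.inr rfl)
  have hu : ‖2 * u‖ ≤ ‖u + Complex.I * v‖ + ‖u + -Complex.I * v‖ :=
    calc _ = ‖(u + Complex.I * v) + (u + -Complex.I * v)‖ := by congr 1; ring
      _ ≤ _ := norm_add_le _ _
  have hv : ‖2 * v‖ ≤ ‖u + Complex.I * v‖ + ‖u + -Complex.I * v‖ :=
    calc ‖2 * v‖ = ‖Complex.I * (2 * v)‖ := by simp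
      _ = ‖(u + Complex.I * v) - (u + -Complex.I * v)‖ := by congr 1; ring
      _ ≤ _ := norm_sub_le _ _
  rw [norm_mul, Complex.norm_ofNat] at hu hv
  constructor <;> linarith

theorem exists_norm_le_mul_exp_and_eq {y : ℝ → ℂ} {t : ℝ} (ht : t ≤ T)
    (hy : ContinuousOn y (Icc t T)) (c : ℝ) :
    ∃ M, (∀ x ∈ Icc t T, ‖y x‖ ≤ M * Real.exp (c * (x - t))) ∧
      ∃ x ∈ Icc t T, ‖y x‖ = M * Real.exp (c * (x - t)) := by
  have hcont : ContinuousOn (fun x => ‖y x‖ / Real.exp (c * (x - t))) (Icc t T) :=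
    hy.norm.div (by fun_prop) fun x _ => (Real.exp_pos _).ne'
  obtain ⟨x₀, hx₀, hmax⟩ := isCompact_Icc.exists_isMaxOn ⟨t, le_rfl, ht⟩ hcont
  exact ⟨_, fun x hx => (div_le_iff₀ (Real.exp_pos _)).1 (hmax hx), x₀, hx₀,
    (div_mul_cancel₀ _ (Real.exp_pos _).ne').symm⟩

theorem PencilSolution.exists_norm_add_mul_sub_exp_le (hT : 0 < T) (hp : HasACDeriv T p p')
    (hq : IntervalIntegrable q volume 0 T) :
    ∃ R : ℝ, 0 ≤ R ∧ ∀ (μ : ℂ) (y z : ℝ → ℂ), PencilSolution T p q μ y z → ∀ t ∈ Icc 0 T,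
      y t = 0 → z t = 1 → ∀ M : ℝ, (∀ s ∈ Icc t T, ‖y s‖ ≤ M * Real.exp (|μ.im| * (s - t))) →
      ∀ ε, (ε = Complex.I ∨ ε = -Complex.I) → ∀ x ∈ Icc t T,
      ‖z x + ε * (μ - p x) * y x - Complex.exp (ε * (pencilPhase p μ x - pencilPhase p μ t))‖ ≤
        R * M * Real.exp (|μ.im| * (x - t)) := by
  obtain ⟨R, hR, H⟩ := exists_norm_integral_remainder_le hT.le hp hq
  refine ⟨R, hR, fun μ y z h t ht hyt hzt M hM ε hε x hx => ?_⟩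
  have hsq : ε * ε = -1 := by rcases hε with rfl | rfl <;> simp
  rw [h.variation_of_constants hT hp hq hsq ht ⟨ht.1.trans hx.1, hx.2⟩, hyt, hzt, mul_zero,
    add_zero, one_mul, add_sub_cancel_left]
  exact H μ ε hε t ht x hx y M fun s hs => hM s ⟨hs.1, hs.2.trans hx.2⟩

theorem PencilSolution.exists_norm_le_of_norm_le (hT : 0 < T) (hp : HasACDeriv T p p')
    (hq : IntervalIntegrable q volume 0 T) :
    ∃ K R : ℝ, 1 ≤ K ∧ 0 ≤ R ∧ ∀ μ : ℂ, K ≤ ‖μ‖ → ∀ y z, PencilSolution T p q μ y z →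
      ∀ t ∈ Icc 0 T, y t = 0 → z t = 1 →
      ∀ M : ℝ, (∀ s ∈ Icc t T, ‖y s‖ ≤ M * Real.exp (|μ.im| * (s - t))) → ∀ x ∈ Icc t T,
        ‖z x‖ ≤ (K + R * M) * Real.exp (|μ.im| * (x - t)) ∧
        ‖μ‖ * ‖y x‖ ≤ 2 * (K + R * M) * Real.exp (|μ.im| * (x - t)) := by
  have hpi : IntervalIntegrable p volume 0 T := hp.ac.continuousOn.intervalIntegrable
  obtain ⟨B, hB⟩ := isCompact_Icc.exists_bound_of_continuousOn (hp.continuousOn hT)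
  obtain ⟨R, hR, H⟩ := exists_norm_add_mul_sub_exp_le hT hp hq
  set K := Real.exp (∫ u in (0 : ℝ)..T, ‖p u‖)
  have hK : 1 ≤ K := Real.one_le_exp
    (intervalIntegral.integral_nonneg hT.le fun _ _ => norm_nonneg _)
  have hB₀ : 0 ≤ B := (norm_nonneg _).trans (hB 0 ⟨le_rfl, hT.le⟩)
  refine ⟨K + 2 * B, R, by linarith, hR, fun μ hμ y z h t ht hyt hzt M hM x hx => ?_⟩
  set E := Real.exp (|μ.im| * (x - t))
  have hBE : 0 ≤ B * E := by positivity
  obtain ⟨hz, hy⟩ := norm_le_of_norm_add_I_mul_le (u := z x) (v := (μ - p x) * y x)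
    (B := (K + 2 * B + R * M) * E) fun ε hε => by
      rw [← mul_assoc]
      linarith [H μ y z h t ht hyt hzt M hM ε hε x hx, norm_sub_norm_le
        (z x + ε * (μ - p x) * y x) (Complex.exp (ε * (pencilPhase p μ x - pencilPhase p μ t))),
        norm_exp_pencilPhase_le_exp_abs_im hpi hε μ ht.1 hx.1 hx.2]
  have hρ : ‖μ‖ ≤ 2 * ‖μ - p x‖ := by
    linarith [norm_sub_norm_le μ (p x), hB x ⟨ht.1.trans hx.1, hx.2⟩]
  refine ⟨hz, ?_⟩
  calc ‖μ‖ * ‖y x‖ ≤ 2 * ‖μ - p x‖ * ‖y x‖ := by gcongr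
    _ = 2 * ‖(μ - p x) * y x‖ := by rw [norm_mul, mul_assoc]
    _ ≤ _ := by linarith

-- Bootstrapping: the best constant `M` in `‖y‖ ≤ M exp (|Im μ| (x - t))` satisfies
-- `‖μ‖ M ≤ 2 (K + R M)`, so it is `O(1 / ‖μ‖)`.
theorem PencilSolution.exists_norm_le (hT : 0 < T) (hp : HasACDeriv T p p')
    (hq : IntervalIntegrable q volume 0 T) :
    ∃ K : ℝ, 1 ≤ K ∧ ∀ μ : ℂ, K ≤ ‖μ‖ → ∀ y z, PencilSolution T p q μ y z → ∀ t ∈ Icc 0 T,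
      y t = 0 → z t = 1 → ∀ x ∈ Icc t T,
        ‖y x‖ ≤ K * Real.exp (|μ.im| * (x - t)) / ‖μ‖ ∧
        ‖z x‖ ≤ K * Real.exp (|μ.im| * (x - t)) := by
  obtain ⟨K, R, hK, hR, H⟩ := exists_norm_le_of_norm_le hT hp hq
  refine ⟨4 * K + 4 * R, by linarith, fun μ hμ y z h t ht hyt hzt => ?_⟩
  obtain ⟨M, hM, x₀, hx₀, hMx₀⟩ := exists_norm_le_mul_exp_and_eq ht.2
    (h.continuousOn.mono (Icc_subset_Icc_left ht.1)) |μ.im|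
  have hyz := H μ (by linarith) y z h t ht hyt hzt M hM
  have hbest : ‖μ‖ * M ≤ 2 * (K + R * M) := by
    have := (hyz x₀ hx₀).2
    rw [hMx₀, ← mul_assoc] at this
    exact le_of_mul_le_mul_right this (Real.exp_pos _)
  have hM₀ : 0 ≤ M := by simpa using (norm_nonneg _).trans (hM t ⟨le_rfl, ht.2⟩)
  have hRM : R * M ≤ K := by nlinarith
  intro x hx
  obtain ⟨hz, hy⟩ := hyz x hx
  rw [le_div_iff₀ (by linarith), mul_comm ‖y x‖]
  exact ⟨hy.trans (mul_le_mul_of_nonneg_right (by linarith) (Real.exp_nonneg _)),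
    hz.trans (mul_le_mul_of_nonneg_right (by linarith) (Real.exp_nonneg _))⟩

end Phase

/-- The Cauchy function `C(t, x)`: the solution in `x` with `C(t, t) = 0` and `C'(t, t) = 1`. -/
noncomputable def cauchyKernel (T : ℝ) (p q : ℝ → ℂ) (μ : ℂ) (t x : ℝ) : ℂ :=
  (initialSolution T p q μ 1 0).1 t * (initialSolution T p q μ 0 1).1 x -
    (initialSolution T p q μ 0 1).1 t * (initialSolution T p q μ 1 0).1 x

/-- The derivative of the Cauchy function in the second variable. -/
noncomputable def cauchyKernelDeriv (T : ℝ) (p q : ℝ → ℂ) (μ : ℂ) (t x : ℝ) : ℂ :=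
  (initialSolution T p q μ 1 0).1 t * (initialSolution T p q μ 0 1).2 x -
    (initialSolution T p q μ 0 1).1 t * (initialSolution T p q μ 1 0).2 x

section Kernel

variable {T : ℝ} {p p' q : ℝ → ℂ}

theorem initialSolution_wronskian (hT : 0 < T) (hp : IntervalIntegrable p volume 0 T)
    (hq : IntervalIntegrable q volume 0 T) (μ : ℂ) {x : ℝ} (hx : x ∈ Icc 0 T) :
    (initialSolution T p q μ 1 0).1 x * (initialSolution T p q μ 0 1).2 x -
      (initialSolution T p q μ 1 0).2 x * (initialSolution T p q μ 0 1).1 x = 1 := by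
  obtain ⟨hX₁, h₁, h₁'⟩ := initialSolution_spec hT.le hp hq μ 1 0
  obtain ⟨hX₂, h₂, h₂'⟩ := initialSolution_spec hT.le hp hq μ 0 1
  rw [hX₁.wronskian_eq hT hp hq hX₂ hx ⟨le_rfl, hT.le⟩, h₁, h₁', h₂, h₂']
  ring

theorem cauchyKernel_self (μ : ℂ) (t : ℝ) : cauchyKernel T p q μ t t = 0 := by
  simp only [cauchyKernel]
  ring

theorem cauchyKernel_swap (μ : ℂ) (t x : ℝ) :
    cauchyKernel T p q μ t x = -cauchyKernel T p q μ x t := by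
  simp only [cauchyKernel]
  ring

theorem cauchyKernelDeriv_self (hT : 0 < T) (hp : IntervalIntegrable p volume 0 T)
    (hq : IntervalIntegrable q volume 0 T) (μ : ℂ) {t : ℝ} (ht : t ∈ Icc 0 T) :
    cauchyKernelDeriv T p q μ t t = 1 := by
  simp only [cauchyKernelDeriv]
  linear_combination initialSolution_wronskian hT hp hq μ ht

theorem pencilSolution_cauchyKernel (hT : 0 ≤ T) (hp : IntervalIntegrable p volume 0 T)
    (hq : IntervalIntegrable q volume 0 T) (μ : ℂ) (t : ℝ) :
    PencilSolution T p q μ (cauchyKernel T p q μ t) (cauchyKernelDeriv T p q μ t) := by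
  obtain ⟨hX₁, -⟩ := initialSolution_spec hT hp hq μ 1 0
  obtain ⟨hX₂, -⟩ := initialSolution_spec hT hp hq μ 0 1
  convert hX₂.combination hX₁ ((initialSolution T p q μ 1 0).1 t)
    (-(initialSolution T p q μ 0 1).1 t) using 1
  · ext x; simp only [cauchyKernel]; ring
  · ext x; simp only [cauchyKernelDeriv]; ring

theorem exists_norm_cauchyKernel_le (hT : 0 < T) (hp : HasACDeriv T p p')
    (hq : IntervalIntegrable q volume 0 T) :
    ∃ K : ℝ, 1 ≤ K ∧ ∀ μ : ℂ, K ≤ ‖μ‖ → ∀ t ∈ Icc 0 T, ∀ x ∈ Icc t T,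
      ‖cauchyKernel T p q μ t x‖ ≤ K * Real.exp (|μ.im| * (x - t)) / ‖μ‖ ∧
      ‖cauchyKernelDeriv T p q μ t x‖ ≤ K * Real.exp (|μ.im| * (x - t)) := by
  have hpi : IntervalIntegrable p volume 0 T := hp.ac.continuousOn.intervalIntegrable
  obtain ⟨K, hK, H⟩ := PencilSolution.exists_norm_le hT hp hq
  exact ⟨K, hK, fun μ hμ t ht => H μ hμ _ _ (pencilSolution_cauchyKernel hT.le hpi hq μ t) t ht
    (cauchyKernel_self μ t) (cauchyKernelDeriv_self hT hpi hq μ ht)⟩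

theorem exists_norm_cauchyKernelDeriv_add_sub_exp_le (hT : 0 < T) (hp : HasACDeriv T p p')
    (hq : IntervalIntegrable q volume 0 T) :
    ∃ K : ℝ, ∀ μ : ℂ, K ≤ ‖μ‖ → ∀ t ∈ Icc 0 T, ∀ ε, (ε = Complex.I ∨ ε = -Complex.I) →
      ∀ x ∈ Icc t T, ‖cauchyKernelDeriv T p q μ t x + ε * (μ - p x) * cauchyKernel T p q μ t x -
        Complex.exp (ε * (pencilPhase p μ x - pencilPhase p μ t))‖ ≤
          K * Real.exp (|μ.im| * (x - t)) / ‖μ‖ := by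
  have hpi : IntervalIntegrable p volume 0 T := hp.ac.continuousOn.intervalIntegrable
  obtain ⟨K, hK, hbound⟩ := exists_norm_cauchyKernel_le hT hp hq
  obtain ⟨R, hR, H⟩ := PencilSolution.exists_norm_add_mul_sub_exp_le hT hp hq
  refine ⟨K + R * K, fun μ hμ t ht ε hε x hx => ?_⟩
  have hRK : 0 ≤ R * K := by positivity
  have hM : ∀ s ∈ Icc t T,
      ‖cauchyKernel T p q μ t s‖ ≤ K / ‖μ‖ * Real.exp (|μ.im| * (s - t)) := fun s hs => by
    rw [div_mul_eq_mul_div]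
    exact (hbound μ (by linarith) t ht s hs).1
  calc _ ≤ R * (K / ‖μ‖) * Real.exp (|μ.im| * (x - t)) :=
        H μ _ _ (pencilSolution_cauchyKernel hT.le hpi hq μ t) t ht (cauchyKernel_self μ t)
          (cauchyKernelDeriv_self hT hpi hq μ ht) _ hM ε hε x hx
    _ = R * K * Real.exp (|μ.im| * (x - t)) / ‖μ‖ := by ring
    _ ≤ _ := by gcongr; linarith

/-! ### Asymptotics as `Im μ → ∞` -/

theorem tendsto_norm_comap_im : Tendsto (fun μ : ℂ => ‖μ‖) (comap Complex.im atTop) atTop :=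
  tendsto_atTop_mono (fun μ => (le_abs_self _).trans (Complex.abs_im_le_norm μ)) tendsto_comap

theorem tendsto_div_sub_const_comap_im (c : ℂ) :
    Tendsto (fun μ : ℂ => μ / (μ - c)) (comap Complex.im atTop) (𝓝 1) := by
  have hnorm : Tendsto (fun μ : ℂ => ‖μ - c‖) (comap Complex.im atTop) atTop :=
    tendsto_atTop_mono (fun μ => norm_sub_norm_le μ c)
      (tendsto_atTop_add_const_right _ _ tendsto_norm_comap_im)
  have hinv : Tendsto (fun μ : ℂ => 1 + c * (μ - c)⁻¹) (comap Complex.im atTop) (𝓝 1) := by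
    simpa using ((tendsto_inv₀_cobounded.comp
      (tendsto_norm_atTop_iff_cobounded.1 hnorm)).const_mul c).const_add 1
  refine hinv.congr' ?_
  filter_upwards [hnorm.eventually_gt_atTop 0] with μ hμ
  have : μ - c ≠ 0 := norm_pos_iff.1 hμ
  field_simp
  ring

theorem tendsto_exp_I_mul_pencilPhase (hp : IntervalIntegrable p volume 0 T) {a : ℝ}
    (ha : a ∈ Ioc 0 T) :
    Tendsto (fun μ => Complex.exp (Complex.I * pencilPhase p μ a)) (comap Complex.im atTop)
      (𝓝 0) := by
  have hlin : Tendsto (fun μ : ℂ => a * μ.im) (comap Complex.im atTop) atTop :=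
    tendsto_comap.const_mul_atTop ha.1
  refine squeeze_zero_norm (fun μ => norm_exp_I_mul_pencilPhase_le hp μ ⟨ha.1.le, ha.2⟩) ?_
  simpa using (Real.tendsto_exp_neg_atTop_nhds_zero.comp hlin).const_mul
    (Real.exp (∫ u in (0 : ℝ)..T, ‖p u‖))

theorem tendsto_cauchyKernelDeriv_add_sub_exp (hT : 0 < T) (hp : HasACDeriv T p p')
    (hq : IntervalIntegrable q volume 0 T) {a : ℝ} (ha : a ∈ Icc 0 T) {ε : ℂ}
    (hε : ε = Complex.I ∨ ε = -Complex.I) :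
    Tendsto (fun μ => (cauchyKernelDeriv T p q μ 0 a + ε * (μ - p a) * cauchyKernel T p q μ 0 a -
      Complex.exp (ε * pencilPhase p μ a)) * Complex.exp (Complex.I * pencilPhase p μ a))
      (comap Complex.im atTop) (𝓝 0) := by
  have hpi : IntervalIntegrable p volume 0 T := hp.ac.continuousOn.intervalIntegrable
  obtain ⟨K, H⟩ := exists_norm_cauchyKernelDeriv_add_sub_exp_le hT hp hq
  set K' := Real.exp (∫ u in (0 : ℝ)..T, ‖p u‖)
  refine squeeze_zero_norm' ?_ (tendsto_norm_comap_im.const_div_atTop (K * K'))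
  filter_upwards [tendsto_norm_comap_im.eventually_ge_atTop K,
    tendsto_comap.eventually_ge_atTop 0] with μ hμ him
  have hK := H μ hμ 0 ⟨le_rfl, hT.le⟩ ε hε a ha
  rw [pencilPhase_zero, sub_zero, sub_zero, abs_of_nonneg him] at hK
  rw [norm_mul]
  calc _ ≤ K * Real.exp (μ.im * a) / ‖μ‖ * (K' * Real.exp (-(a * μ.im))) :=
        mul_le_mul hK (norm_exp_I_mul_pencilPhase_le hpi μ ha) (norm_nonneg _)
          ((norm_nonneg _).trans hK)
    _ = K * K' / ‖μ‖ * (Real.exp (μ.im * a) * Real.exp (-(a * μ.im))) := by ring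
    _ = K * K' / ‖μ‖ := by rw [← Real.exp_add, mul_comm a, add_neg_cancel, Real.exp_zero, mul_one]

theorem tendsto_cauchyKernelDeriv_add_mul_exp (hT : 0 < T) (hp : HasACDeriv T p p')
    (hq : IntervalIntegrable q volume 0 T) {a : ℝ} (ha : a ∈ Ioc 0 T) :
    Tendsto (fun μ => (cauchyKernelDeriv T p q μ 0 a +
      Complex.I * (μ - p a) * cauchyKernel T p q μ 0 a) *
        Complex.exp (Complex.I * pencilPhase p μ a)) (comap Complex.im atTop) (𝓝 0) := by
  have hexp := tendsto_exp_I_mul_pencilPhase hp.ac.continuousOn.intervalIntegrable ha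
  have hrem := tendsto_cauchyKernelDeriv_add_sub_exp hT hp hq (Ioc_subset_Icc_self ha) (.inl rfl)
  have := hrem.add (hexp.mul hexp)
  rw [mul_zero, add_zero] at this
  exact this.congr fun μ => by ring

theorem tendsto_cauchyKernelDeriv_sub_mul_exp (hT : 0 < T) (hp : HasACDeriv T p p')
    (hq : IntervalIntegrable q volume 0 T) {a : ℝ} (ha : a ∈ Icc 0 T) :
    Tendsto (fun μ => (cauchyKernelDeriv T p q μ 0 a -
      Complex.I * (μ - p a) * cauchyKernel T p q μ 0 a) *
        Complex.exp (Complex.I * pencilPhase p μ a)) (comap Complex.im atTop) (𝓝 1) := by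
  have hrem := (tendsto_cauchyKernelDeriv_add_sub_exp hT hp hq ha (.inr rfl)).add_const 1
  rw [zero_add] at hrem
  refine hrem.congr fun μ => ?_
  have hinv : Complex.exp (-Complex.I * pencilPhase p μ a) *
      Complex.exp (Complex.I * pencilPhase p μ a) = 1 := by
    rw [← Complex.exp_add, neg_mul, neg_add_cancel, Complex.exp_zero]
  linear_combination -hinv

theorem tendsto_mul_cauchyKernel_zero_mul_exp (hT : 0 < T) (hp : HasACDeriv T p p')
    (hq : IntervalIntegrable q volume 0 T) {a : ℝ} (ha : a ∈ Ioc 0 T) :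
    Tendsto (fun μ => μ * cauchyKernel T p q μ 0 a * Complex.exp (Complex.I * pencilPhase p μ a))
      (comap Complex.im atTop) (𝓝 (Complex.I / 2)) := by
  have hlim := ((tendsto_cauchyKernelDeriv_sub_mul_exp hT hp hq (Ioc_subset_Icc_self ha)).sub
    (tendsto_cauchyKernelDeriv_add_mul_exp hT hp hq ha)).mul
    ((tendsto_div_sub_const_comap_im (p a)).mul_const (Complex.I / 2))
  rw [sub_zero, one_mul, one_mul] at hlim
  refine hlim.congr' ?_
  filter_upwards [tendsto_norm_comap_im.eventually_gt_atTop ‖p a‖] with μ hμ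
  have : μ - p a ≠ 0 := fun h => hμ.ne' (by rw [sub_eq_zero.1 h])
  field_simp
  ring_nf
  simp only [Complex.I_sq]
  ring

theorem tendsto_cauchyKernelDeriv_zero_mul_exp (hT : 0 < T) (hp : HasACDeriv T p p')
    (hq : IntervalIntegrable q volume 0 T) {a : ℝ} (ha : a ∈ Ioc 0 T) :
    Tendsto (fun μ => cauchyKernelDeriv T p q μ 0 a *
      Complex.exp (Complex.I * pencilPhase p μ a)) (comap Complex.im atTop) (𝓝 (1 / 2)) := by
  have hlim := ((tendsto_cauchyKernelDeriv_sub_mul_exp hT hp hq (Ioc_subset_Icc_self ha)).add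
    (tendsto_cauchyKernelDeriv_add_mul_exp hT hp hq ha)).mul_const (1 / 2)
  rw [add_zero, one_mul] at hlim
  exact hlim.congr fun μ => by ring

end Kernel

/-! ### Complex measures -/

section ComplexMeasure

variable {X : Type*} [MeasurableSpace X] (c : ComplexMeasure X)

instance isFiniteMeasure_variation_complexMeasure : IsFiniteMeasure c.variation := by
  refine isFiniteMeasure_of_le
    ((ComplexMeasure.re c).totalVariation + (ComplexMeasure.im c).totalVariation)
    (VectorMeasure.variation_le_of_forall_enorm_le fun s _ => ?_)
  calc ‖c s‖ₑ = ‖((c s).re : ℂ) + (c s).im * Complex.I‖ₑ := by rw [Complex.re_add_im]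
    _ ≤ ‖ComplexMeasure.re c s‖ₑ + ‖ComplexMeasure.im c s‖ₑ := by
        refine (enorm_add_le _ _).trans_eq ?_
        simp only [← ofReal_norm, norm_mul, Complex.norm_real, Complex.norm_I, mul_one]
        rfl
    _ ≤ _ := add_le_add (SignedMeasure.enorm_le_totalVariation _ s)
        (SignedMeasure.enorm_le_totalVariation _ s)

theorem complexMeasure_integral_const_mul {f : X → ℂ} (hf : c.Integrable f) (k : ℂ) :
    ∫ᵛ x, k * f x ∂[ContinuousLinearMap.mul ℝ ℂ; c] =
      k * ∫ᵛ x, f x ∂[ContinuousLinearMap.mul ℝ ℂ; c] := by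
  have h := VectorMeasure.continuousLinearMap_apply_integral (B := ContinuousLinearMap.mul ℝ ℂ)
    (C := ContinuousLinearMap.mul ℝ ℂ k) hf
  have h' := VectorMeasure.integral_continuousLinearMap_comp (B := ContinuousLinearMap.mul ℝ ℂ)
    (C := ContinuousLinearMap.mul ℝ ℂ k) hf
  simp only [ContinuousLinearMap.mul_apply'] at h h'
  rw [h, h']
  congr 1
  ext
  simp [mul_assoc]

variable [TopologicalSpace X] [CompactSpace X] [BorelSpace X]

theorem complexMeasure_integrable_of_continuous {f : X → ℂ} (hf : Continuous f) :
    c.Integrable f := by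
  obtain ⟨C, hC⟩ := isCompact_univ.exists_bound_of_continuousOn hf.continuousOn
  exact .of_bound hf.aestronglyMeasurable C (.of_forall fun x => hC x trivial)

theorem differentiable_complexMeasure_integral {Y : ℂ → C(X, ℂ)} (hY : Differentiable ℂ Y) :
    Differentiable ℂ fun μ => ∫ᵛ x, Y μ x ∂[ContinuousLinearMap.mul ℝ ℂ; c] := by
  have hint (f : C(X, ℂ)) : c.Integrable f := complexMeasure_integrable_of_continuous c f.continuous
  let L : C(X, ℂ) →L[ℂ] ℂ := LinearMap.mkContinuous
    { toFun := fun f => ∫ᵛ x, f x ∂[ContinuousLinearMap.mul ℝ ℂ; c]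
      map_add' := fun f g => VectorMeasure.integral_add (hint f) (hint g)
      map_smul' := fun k f => complexMeasure_integral_const_mul c (hint f) k }
    (‖ContinuousLinearMap.mul ℝ ℂ‖ * c.variation.real univ) fun f => by
      refine (VectorMeasure.norm_integral_le_of_norm_le_const
        (.of_forall f.norm_coe_le_norm)).trans_eq ?_
      ring
  exact L.differentiable.comp hY

end ComplexMeasure

/-- The functional `y ↦ ∫_0^T y dc` attached to a complex measure `c` on `[0, T]`. -/
noncomputable def measureForm {T : ℝ} (c : ComplexMeasure (Icc (0 : ℝ) T)) (y : ℝ → ℂ) : ℂ :=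
  ∫ᵛ t, y t ∂[ContinuousLinearMap.mul ℝ ℂ; c]

/-- The part of a complex measure on `[0, T]` that lives on `[0, a]`. -/
noncomputable def truncatedMeasure {T : ℝ} (c : ComplexMeasure (Icc (0 : ℝ) T)) (a : ℝ) :
    ComplexMeasure (Icc (0 : ℝ) T) :=
  c.restrict {t | (t : ℝ) ≤ a}

section MeasureForm

variable {T : ℝ} (c : ComplexMeasure (Icc (0 : ℝ) T)) {a : ℝ} {y z : ℝ → ℂ}

theorem measurableSet_coe_le (T a : ℝ) : MeasurableSet {t : Icc (0 : ℝ) T | (t : ℝ) ≤ a} :=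
  measurable_subtype_coe measurableSet_Iic

theorem truncatedMeasure_self : truncatedMeasure c T = c := by
  have h : {t : Icc (0 : ℝ) T | (t : ℝ) ≤ T} = univ := eq_univ_of_forall fun t => t.2.2
  rw [truncatedMeasure, h, VectorMeasure.restrict_univ]

theorem integrable_coe_of_continuousOn (hy : ContinuousOn y (Icc 0 T)) :
    c.Integrable fun t : Icc (0 : ℝ) T => y t :=
  complexMeasure_integrable_of_continuous c (continuousOn_iff_continuous_domRestrict.1 hy)

theorem measureForm_const_mul (hy : ContinuousOn y (Icc 0 T)) (k : ℂ) :
    measureForm c (fun t => k * y t) = k * measureForm c y :=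
  complexMeasure_integral_const_mul c (integrable_coe_of_continuousOn c hy) k

theorem measureForm_combination (hy : ContinuousOn y (Icc 0 T)) (hz : ContinuousOn z (Icc 0 T))
    (k l : ℂ) :
    measureForm c (fun t => k * y t + l * z t) = k * measureForm c y + l * measureForm c z := by
  rw [← measureForm_const_mul c hy, ← measureForm_const_mul c hz]
  exact VectorMeasure.integral_add
    (integrable_coe_of_continuousOn c (y := fun t => k * y t) (continuousOn_const.mul hy))
    (integrable_coe_of_continuousOn c (y := fun t => l * z t) (continuousOn_const.mul hz))

theorem norm_measureForm_truncatedMeasure_le {C : ℝ} (hC : 0 ≤ C)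
    (h : ∀ t ∈ Icc 0 T, t ≤ a → ‖y t‖ ≤ C) :
    ‖measureForm (truncatedMeasure c a) y‖ ≤
      C * (‖ContinuousLinearMap.mul ℝ ℂ‖ * c.variation.real univ) := by
  have hA := VectorMeasure.norm_setIntegral_le_of_norm_le_const (μ := c)
    (B := ContinuousLinearMap.mul ℝ ℂ) (s := {t : Icc (0 : ℝ) T | (t : ℝ) ≤ a})
    (f := fun t => y t) fun t ht => h t t.2 ht
  have hmono := measureReal_mono (μ := c.variation)
    (subset_univ {t : Icc (0 : ℝ) T | (t : ℝ) ≤ a})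
  rw [mul_assoc] at hA
  exact hA.trans (by gcongr)

theorem measureForm_truncatedMeasure_eq (hy : ContinuousOn y (Icc 0 T))
    (hz : ContinuousOn z (Icc 0 T)) (h : measureForm c y = measureForm c z)
    (hyz : EqOn y z (Icc a T)) :
    measureForm (truncatedMeasure c a) y = measureForm (truncatedMeasure c a) z := by
  have hA := measurableSet_coe_le T a
  have hcompl : ∫ᵛ t in {t : Icc (0 : ℝ) T | (t : ℝ) ≤ a}ᶜ, y t ∂[ContinuousLinearMap.mul ℝ ℂ; c] =
      ∫ᵛ t in {t : Icc (0 : ℝ) T | (t : ℝ) ≤ a}ᶜ, z t ∂[ContinuousLinearMap.mul ℝ ℂ; c] :=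
    VectorMeasure.setIntegral_congr_fun fun t (ht : ¬(t : ℝ) ≤ a) =>
      hyz ⟨(not_le.1 ht).le, t.2.2⟩
  rw [measureForm, measureForm,
    ← VectorMeasure.setIntegral_add_compl hA (integrable_coe_of_continuousOn c hy),
    ← VectorMeasure.setIntegral_add_compl hA (integrable_coe_of_continuousOn c hz),
    hcompl] at h
  exact add_right_cancel h

theorem tendsto_exp_neg_mul_im_comap_im {t : ℝ} (ht : 0 < t) :
    Tendsto (fun μ : ℂ => Real.exp (-(t * μ.im))) (comap Complex.im atTop) (𝓝 0) :=
  Real.tendsto_exp_atBot.comp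
    (tendsto_neg_atTop_atBot.comp (tendsto_comap.const_mul_atTop ht))

-- The weight `e^{-t Im μ}` concentrates the integral at the mass of `c` at `t = 0`.
theorem tendsto_measureForm_truncatedMeasure (hT : 0 ≤ T) (ha : 0 ≤ a) {f : ℂ → ℝ → ℂ}
    (hf : ∀ μ, ContinuousOn (f μ) (Icc 0 T)) {C : ℝ}
    (hC : ∀ᶠ μ in comap Complex.im atTop, ∀ t ∈ Icc 0 T, t ≤ a →
      ‖f μ t‖ ≤ C * Real.exp (-(t * μ.im))) {k : ℂ}
    (h0 : Tendsto (fun μ => f μ 0) (comap Complex.im atTop) (𝓝 k)) :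
    Tendsto (fun μ => measureForm (truncatedMeasure c a) (f μ)) (comap Complex.im atTop)
      (𝓝 (k * c {⟨0, le_rfl, hT⟩})) := by
  classical
  let o : Icc (0 : ℝ) T := ⟨0, le_rfl, hT⟩
  have hA := measurableSet_coe_le T a
  have hinter : {t : Icc (0 : ℝ) T | (t : ℝ) ≤ a} ∩ {o} = {o} :=
    inter_eq_right.2 (singleton_subset_iff.2 ha)
  have hvar : (truncatedMeasure c a).variation =
      c.variation.restrict {t : Icc (0 : ℝ) T | (t : ℝ) ≤ a} :=
    VectorMeasure.variation_restrict hA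
  have hlim : k * c {o} = ∫ᵛ t in {t : Icc (0 : ℝ) T | (t : ℝ) ≤ a},
      ({o} : Set (Icc (0 : ℝ) T)).indicator (fun _ => k) t ∂[ContinuousLinearMap.mul ℝ ℂ; c] := by
    rw [VectorMeasure.setIntegral_indicator hA (measurableSet_singleton o),
      hinter, VectorMeasure.integral_singleton]
    rfl
  rw [hlim]
  refine VectorMeasure.tendsto_integral_filter_of_norm_le_const
    (.of_forall fun μ => (integrable_coe_of_continuousOn _ (hf μ)).aestronglyMeasurable)
    ⟨|C|, ?_⟩ ?_ <;> rw [hvar]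
  · filter_upwards [hC, tendsto_comap.eventually_ge_atTop 0] with μ hμ him
    filter_upwards [ae_restrict_mem hA] with t ht
    refine (hμ t t.2 ht).trans ?_
    have hexp : Real.exp (-(t * μ.im)) ≤ 1 :=
      Real.exp_le_one_iff.2 (neg_nonpos.2 (mul_nonneg t.2.1 him))
    exact (mul_le_mul_of_nonneg_right (le_abs_self C) (Real.exp_nonneg _)).trans
      (mul_le_of_le_one_right (abs_nonneg C) hexp)
  · filter_upwards [ae_restrict_mem hA] with t ht
    by_cases hto : t = o
    · subst hto
      simpa using h0
    · have htp : 0 < (t : ℝ) := lt_of_le_of_ne t.2.1 fun h => hto (Subtype.ext h.symm)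
      rw [indicator_of_notMem (by simpa using hto)]
      refine squeeze_zero_norm' (hC.mono fun μ h => h t t.2 ht) ?_
      simpa using (tendsto_exp_neg_mul_im_comap_im htp).const_mul C

end MeasureForm

/-! ### Functions of exponential type -/

theorem circleAverage_mono_codiscreteWithin {f g : ℂ → ℝ} {c : ℂ} {R : ℝ} (hR : R ≠ 0)
    (hf : CircleIntegrable f c R) (hg : CircleIntegrable g c R)
    (hfg : ∀ᶠ z in codiscreteWithin (Metric.sphere c |R|), f z ≤ g z) :
    Real.circleAverage f c R ≤ Real.circleAverage g c R := by
  have hmin : f =ᶠ[codiscreteWithin (Metric.sphere c |R|)] fun z => min (f z) (g z) :=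
    hfg.mono fun z hz => (min_eq_left hz).symm
  rw [Real.circleAverage_congr_codiscreteWithin hmin hR]
  exact Real.circleAverage_mono (hf.congr_codiscreteWithin hmin) hg fun z _ => min_le_right _ _

theorem log_norm_le_circleAverage {f : ℂ → ℂ} {c : ℂ} {R : ℝ} (hR : 0 < R)
    (hf : AnalyticOnNhd ℂ f (Metric.closedBall c R)) (hc : f c ≠ 0) :
    Real.log ‖f c‖ ≤ Real.circleAverage (fun z => Real.log ‖f z‖) c R := by
  rw [← abs_of_pos hR] at hf
  rw [AnalyticOnNhd.circleAverage_log_norm hR.ne' hf hc]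
  refine le_add_of_nonneg_left (finsum_nonneg fun u => ?_)
  by_cases hu : u ∈ Metric.closedBall c |R|
  · refine mul_nonneg (mod_cast MeromorphicOn.AnalyticOnNhd.divisor_nonneg hf u) ?_
    rcases eq_or_ne u c with rfl | hne
    · simp
    · have hpos : 0 < ‖c - u‖ := norm_pos_iff.2 (sub_ne_zero.2 hne.symm)
      rw [abs_of_pos hR, mem_closedBall_iff_norm'] at hu
      exact Real.log_nonneg (by rwa [← div_eq_mul_inv, one_le_div hpos])
  · simp [hu]

theorem le_three_mul_circleAverage_of_harmonicOnNhd {u v : ℂ → ℝ} {c w : ℂ} {R : ℝ} (hR : 0 < R)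
    (hw : 2 * ‖w - c‖ ≤ R) (hu : InnerProductSpace.HarmonicOnNhd u (Metric.closedBall c R))
    (hv : CircleIntegrable v c R)
    (huv : ∀ᶠ z in codiscreteWithin (Metric.sphere c |R|), u z ≤ v z ∧ 0 ≤ v z) :
    u w ≤ 3 * Real.circleAverage v c R := by
  have := norm_nonneg (w - c)
  have hwb : w ∈ Metric.ball c R := mem_ball_iff_norm.2 (by linarith)
  have hcont : ContinuousOn ((Complex.re ∘ herglotzRieszKernel c w) • u) (Metric.sphere c |R|) :=
    (Complex.continuous_re.comp_continuousOn (continuousOn_herglotzRieszKernel_sphere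
      hwb)).smul fun z hz =>
      (hu z (Metric.sphere_subset_closedBall (by rwa [abs_of_pos hR] at hz))).1.continuousAt
        |>.continuousWithinAt
  rw [← hu.circleAverage_re_herglotzRieszKernel_smul hwb, ← smul_eq_mul (3 : ℝ),
    ← Real.circleAverage_fun_smul]
  refine circleAverage_mono_codiscreteWithin hR.ne' (hcont.circleIntegrable')
    (hv.const_smul (a := (3 : ℝ))) ?_
  filter_upwards [huv, self_mem_codiscreteWithin _] with z ⟨huz, hvz⟩ hz
  rw [abs_of_pos hR] at hz
  have hupper := re_herglotzRieszKernel_le hz hwb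
  have hlower := le_re_herglotzRieszKernel hz hwb
  have hthree : (R + ‖w - c‖) / (R - ‖w - c‖) ≤ 3 := by
    rw [div_le_iff₀ (by linarith)]; linarith
  have hzero : 0 ≤ (R - ‖w - c‖) / (R + ‖w - c‖) := div_nonneg (by linarith) (by positivity)
  calc (herglotzRieszKernel c w z).re * u z ≤ (herglotzRieszKernel c w z).re * v z :=
        mul_le_mul_of_nonneg_left huz (hzero.trans hlower)
    _ ≤ 3 * v z := mul_le_mul_of_nonneg_right (hupper.trans hthree) hvz

/-- Functions of finite exponential type, `‖f z‖ ≤ exp (C (1 + ‖z‖))`. -/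
def IsExpType (f : ℂ → ℂ) : Prop :=
  ∃ C : ℝ, 0 ≤ C ∧ ∀ z, ‖f z‖ ≤ Real.exp (C * (1 + ‖z‖))

namespace IsExpType

theorem of_norm_le_exp_im {f : ℂ → ℂ} (hf : Continuous f) {K B : ℝ} (hB : 0 ≤ B)
    (h : ∀ z, K ≤ ‖z‖ → ‖f z‖ ≤ K * Real.exp (|z.im| * B)) : IsExpType f := by
  obtain ⟨M, hM⟩ := (isCompact_closedBall (0 : ℂ) K).exists_bound_of_continuousOn hf.continuousOn
  set C := max (max M K) B
  have hC0 : 0 ≤ C := hB.trans (le_max_right _ _)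
  have hconst : ∀ m, m ≤ max M K → m ≤ Real.exp C := fun m hm => by
    linarith [Real.add_one_le_exp C, le_max_left (max M K) B]
  refine ⟨C, hC0, fun z => ?_⟩
  rw [mul_add, mul_one, Real.exp_add]
  rcases le_total K ‖z‖ with hz | hz
  · refine (h z hz).trans ?_
    rw [mul_comm |z.im|]
    gcongr
    · exact hconst K (le_max_right _ _)
    · exact le_max_right _ _
    · exact Complex.abs_im_le_norm z
  · exact (hM z (by simpa using hz)).trans ((hconst M (le_max_left _ _)).trans
      (le_mul_of_one_le_right (Real.exp_pos _).le (Real.one_le_exp (by positivity))))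

theorem isBounded_range_of_strip {f : ℂ → ℂ} (hf : Differentiable ℂ f) (hexp : IsExpType f)
    {R M : ℝ} (h : ∀ z : ℂ, R ≤ |z.im| → ‖f z‖ ≤ M) : Bornology.IsBounded (range f) := by
  obtain ⟨C, hC, hfC⟩ := hexp
  refine (Metric.isBounded_iff_subset_closedBall 0).2 ⟨M, ?_⟩
  rintro _ ⟨z, rfl⟩
  rw [mem_closedBall_zero_iff]
  rcases le_total R |z.im| with hz | hz
  · exact h z hz
  set S := max R 1
  have hSpos : 0 < S := zero_lt_one.trans_le (le_max_right _ _)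
  have hzS := abs_le.1 (hz.trans (le_max_left R 1))
  set c := Real.pi / (4 * S)
  have hcpos : 0 < c := by positivity
  refine PhragmenLindelof.horizontal_strip (a := -S) (b := S) hf.diffContOnCl
    ⟨c, ?_, C * (1 + S) + C / c, ?_⟩ (fun w hw => h w ?_) (fun w hw => h w ?_) hzS.1 hzS.2
  · exact div_lt_div_of_pos_left Real.pi_pos (by linarith) (by linarith)
  · refine Asymptotics.IsBigO.of_bound 1 ?_
    filter_upwards [mem_inf_of_right (mem_principal_self _)] with w hw
    have him : |w.im| ≤ S := abs_le.2 ⟨hw.1.le, hw.2.le⟩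
    have hnorm : ‖w‖ ≤ |w.re| + S := (Complex.norm_le_abs_re_add_abs_im w).trans (by linarith)
    rw [one_mul, Real.norm_eq_abs, abs_of_pos (Real.exp_pos _)]
    refine (hfC w).trans (Real.exp_le_exp.2 ?_)
    have hone : 1 ≤ Real.exp (c * |w.re|) := Real.one_le_exp (by positivity)
    have hlin : c * |w.re| ≤ Real.exp (c * |w.re|) := by linarith [Real.add_one_le_exp (c * |w.re|)]
    calc C * (1 + ‖w‖) ≤ C * (1 + (|w.re| + S)) := by gcongr
      _ = C * (1 + S) * 1 + C / c * (c * |w.re|) := by field_simp; ring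
      _ ≤ C * (1 + S) * Real.exp (c * |w.re|) + C / c * Real.exp (c * |w.re|) := by gcongr
      _ = _ := by ring
  · rw [hw, abs_neg, abs_of_pos hSpos]; exact le_max_left _ _
  · rw [hw, abs_of_pos hSpos]; exact le_max_left _ _

theorem eq_of_tendsto {f : ℂ → ℂ} (hf : Differentiable ℂ f) (hexp : IsExpType f) {L L' : ℂ}
    (hL : Tendsto f (comap Complex.im atTop) (𝓝 L))
    (hL' : Tendsto f (comap Complex.im atBot) (𝓝 L')) (z : ℂ) : f z = L := by
  obtain ⟨R₁, -, hR₁⟩ := ((atTop_basis.comap Complex.im).eventually_iff).1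
    (hL.norm.eventually_le_const (lt_add_one ‖L‖))
  obtain ⟨R₂, -, hR₂⟩ := ((atBot_basis.comap Complex.im).eventually_iff).1
    (hL'.norm.eventually_le_const (lt_add_one ‖L'‖))
  have hbdd : Bornology.IsBounded (range f) := by
    refine hexp.isBounded_range_of_strip hf (R := max R₁ (-R₂))
      (M := max (‖L‖ + 1) (‖L'‖ + 1)) fun w hw => ?_
    obtain ⟨h₁, h₂⟩ := max_le_iff.1 hw
    rcases abs_cases w.im with ⟨hw, -⟩ | ⟨hw, -⟩
    · exact (hR₁ (show R₁ ≤ w.im by linarith)).trans (le_max_left _ _)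
    · exact (hR₂ (show w.im ≤ R₂ by linarith)).trans (le_max_right _ _)
  have : (comap Complex.im atTop).NeBot := atTop_neBot.comap_of_surj Complex.im_surjective
  exact tendsto_nhds_unique
    ((tendsto_congr fun w => hf.apply_eq_apply_of_bounded hbdd w z).2 tendsto_const_nhds) hL

theorem exists_log_norm_le {f : ℂ → ℂ} (hf : IsExpType f) (c : ℂ) :
    ∃ D : ℝ, 0 ≤ D ∧ ∀ z, Real.log ‖f z‖ ≤ D * (1 + ‖z - c‖) := by
  obtain ⟨C, hC, hfC⟩ := hf
  refine ⟨C * (1 + ‖c‖), by positivity, fun z => ?_⟩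
  rcases eq_or_ne (f z) 0 with h0 | h0
  · rw [h0, norm_zero, Real.log_zero]; positivity
  · rw [Real.log_le_iff_le_exp (norm_pos_iff.2 h0)]
    refine (hfC z).trans (Real.exp_le_exp.2 ?_)
    have hz : ‖z‖ ≤ ‖z - c‖ + ‖c‖ := by simpa using norm_add_le (z - c) c
    calc C * (1 + ‖z‖) ≤ C * (1 + (‖z - c‖ + ‖c‖)) := by gcongr
      _ ≤ C * (1 + ‖c‖) * (1 + ‖z - c‖) := by
        nlinarith [mul_nonneg hC (mul_nonneg (norm_nonneg c) (norm_nonneg (z - c)))]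

-- `log ‖g‖` is harmonic, and where `f ≠ 0` it is `log ‖g f‖ - log ‖f‖`; the circle averages of
-- `log ‖f‖` are bounded below by Jensen's inequality.
theorem of_mul {g f : ℂ → ℂ} (hg : Differentiable ℂ g) (hg0 : ∀ z, g z ≠ 0)
    (hf : Differentiable ℂ f) {c : ℂ} (hc : f c ≠ 0) (hef : IsExpType f)
    (hegf : IsExpType (g * f)) : IsExpType g := by
  obtain ⟨C₁, hC₁, hgf_le⟩ := hegf.exists_log_norm_le c
  obtain ⟨C₂, hC₂, hf_le⟩ := hef.exists_log_norm_le c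
  set C := C₁ + C₂
  set l := |Real.log ‖f c‖|
  have hgrowth : ∀ w, Real.log ‖g w‖ ≤ 3 * (C * (2 + 2 * ‖w - c‖) + l) := fun w => by
    set R := 2 * ‖w - c‖ + 1 with hR
    have hRpos : 0 < R := by positivity
    have hlogf : CircleIntegrable (fun z => Real.log ‖f z‖) c R :=
      MeromorphicOn.circleIntegrable_log_norm fun z _ => (hf.analyticAt z).meromorphicAt
    have hconst := circleIntegrable_const (C * (1 + R)) c R
    have hne : ∀ᶠ z in codiscreteWithin (Metric.sphere c |R|), f z ≠ 0 :=
      codiscreteWithin_mono (subset_univ _)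
        (AnalyticOnNhd.preimage_zero_mem_codiscrete (fun z _ => hf.analyticAt z) hc)
    have hharnack := le_three_mul_circleAverage_of_harmonicOnNhd hRpos (c := c) (w := w)
      (by linarith) (u := fun z => Real.log ‖g z‖)
      (v := fun z => C * (1 + R) - Real.log ‖f z‖)
      (fun z _ => (hg.analyticAt z).harmonicAt_log_norm (hg0 z)) (hconst.sub hlogf) (by
        filter_upwards [hne, self_mem_codiscreteWithin _] with z hz hzs
        rw [abs_of_pos hRpos, mem_sphere_iff_norm] at hzs
        have h₁ := hgf_le z
        have h₂ := hf_le z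
        rw [Pi.mul_apply, norm_mul,
          Real.log_mul (norm_ne_zero_iff.2 (hg0 z)) (norm_ne_zero_iff.2 hz)] at h₁
        rw [hzs] at h₁ h₂
        constructor <;> nlinarith)
    have hjensen := log_norm_le_circleAverage hRpos (fun z _ => hf.analyticAt z) hc
    rw [Real.circleAverage_fun_sub hconst hlogf, Real.circleAverage_const] at hharnack
    have := neg_abs_le (Real.log ‖f c‖)
    rw [show (1 + R) = 2 + 2 * ‖w - c‖ by rw [hR]; ring] at hharnack
    linarith
  refine ⟨6 * C * (1 + ‖c‖) + 3 * l, by positivity, fun w => ?_⟩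
  rw [← Real.log_le_iff_le_exp (norm_pos_iff.2 (hg0 w))]
  have hw : C * ‖w - c‖ ≤ C * (‖w‖ + ‖c‖) := by gcongr; exact norm_sub_le _ _
  have hl0 : 0 ≤ l * ‖w‖ := by positivity
  have hcw : 0 ≤ C * (‖c‖ * ‖w‖) := by positivity
  linarith [hgrowth w]

end IsExpType

theorem meromorphicOrderAt_div_eq_zero {f₁ f₂ : ℂ → ℂ} {z : ℂ} (h₁ : AnalyticAt ℂ f₁ z)
    (h₂ : AnalyticAt ℂ f₂ z) (hord : analyticOrderAt f₁ z = analyticOrderAt f₂ z)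
    (htop : analyticOrderAt f₂ z ≠ ⊤) : meromorphicOrderAt (f₁ / f₂) z = 0 := by
  obtain ⟨n, hn⟩ := ENat.ne_top_iff_exists.1 htop
  rw [meromorphicOrderAt_div h₁.meromorphicAt h₂.meromorphicAt, h₁.meromorphicOrderAt_eq,
    h₂.meromorphicOrderAt_eq, hord, ← hn, ENat.map_natCast]
  norm_cast
  simp

theorem exists_differentiable_ne_zero_mul_eq {f₁ f₂ : ℂ → ℂ} (h₁ : Differentiable ℂ f₁)
    (h₂ : Differentiable ℂ f₂) (hord : ∀ z, analyticOrderAt f₁ z = analyticOrderAt f₂ z)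
    {c : ℂ} (hc : f₂ c ≠ 0) :
    ∃ g : ℂ → ℂ, Differentiable ℂ g ∧ (∀ z, g z ≠ 0) ∧ f₁ = g * f₂ := by
  have hm : MeromorphicOn (f₁ / f₂) univ := fun z _ =>
    (h₁.analyticAt z).meromorphicAt.div (h₂.analyticAt z).meromorphicAt
  have htop : ∀ z, analyticOrderAt f₂ z ≠ ⊤ := fun z hz =>
    hc (congrFun ((AnalyticOnNhd.analyticOrderAt_eq_top_iff_eq_zero z h₂.analyticAt).1 hz) c)
  set g := toMeromorphicNFOn (f₁ / f₂) univ
  have hnf : ∀ z, MeromorphicNFAt g z := fun z =>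
    meromorphicNFOn_toMeromorphicNFOn (f₁ / f₂) univ (mem_univ z)
  have hgeq : ∀ z, f₁ / f₂ =ᶠ[𝓝[≠] z] g := fun z =>
    (hm.toMeromorphicNFOn_eq_self_on_nhdsNE (mem_univ z)).symm
  have hord0 : ∀ z, meromorphicOrderAt g z = 0 := fun z => by
    rw [← meromorphicOrderAt_congr (hgeq z)]
    exact meromorphicOrderAt_div_eq_zero (h₁.analyticAt z) (h₂.analyticAt z) (hord z) (htop z)
  have hga : ∀ z, AnalyticAt ℂ g z := fun z =>
    (hnf z).meromorphicOrderAt_nonneg_iff_analyticAt.1 (hord0 z).ge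
  refine ⟨g, fun z => (hga z).differentiableAt,
    fun z => (hnf z).meromorphicOrderAt_eq_zero_iff.1 (hord0 z), funext fun z => ?_⟩
  have hne : ∀ᶠ w in 𝓝[≠] z, f₂ w ≠ 0 :=
    ((h₂.analyticAt z).eventually_eq_zero_or_eventually_ne_zero).resolve_left fun h =>
      htop z (analyticOrderAt_eq_top.2 h)
  have hev : f₁ =ᶠ[𝓝[≠] z] g * f₂ := by
    filter_upwards [hgeq z, hne] with w hw hw'
    rw [Pi.mul_apply, ← hw, Pi.div_apply, div_mul_cancel₀ _ hw']
  exact ((h₁.analyticAt z).continuousAt.eventuallyEq_nhds_iff_eventuallyEq_nhdsNE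
    ((hga z).mul (h₂.analyticAt z)).continuousAt).1 hev |>.eq_of_nhds

theorem tendsto_one_of_tendsto_mul {α : Type*} {l : Filter α} {g f φ : α → ℂ} {L : ℂ} (hL : L ≠ 0)
    (h₁ : Tendsto (fun z => φ z * (g * f) z) l (𝓝 L))
    (h₂ : Tendsto (fun z => φ z * f z) l (𝓝 L)) : Tendsto g l (𝓝 1) := by
  rw [← div_self hL]
  refine (h₁.div h₂ hL).congr' ?_
  filter_upwards [h₂.eventually_ne hL] with z hz
  simp only [Pi.div_apply, Pi.mul_apply, mul_left_comm]
  exact mul_div_cancel_right₀ _ hz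

theorem IsExpType.eq_of_analyticOrderAt_eq {f₁ f₂ : ℂ → ℂ} (h₁ : Differentiable ℂ f₁)
    (h₂ : Differentiable ℂ f₂) (he₁ : IsExpType f₁) (he₂ : IsExpType f₂)
    (hord : ∀ z, analyticOrderAt f₁ z = analyticOrderAt f₂ z) {φ ψ : ℂ → ℂ} {L L' : ℂ}
    (hL : L ≠ 0) (hL' : L' ≠ 0)
    (hφ₁ : Tendsto (fun z => φ z * f₁ z) (comap Complex.im atTop) (𝓝 L))
    (hφ₂ : Tendsto (fun z => φ z * f₂ z) (comap Complex.im atTop) (𝓝 L))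
    (hψ₁ : Tendsto (fun z => ψ z * f₁ z) (comap Complex.im atBot) (𝓝 L'))
    (hψ₂ : Tendsto (fun z => ψ z * f₂ z) (comap Complex.im atBot) (𝓝 L')) : f₁ = f₂ := by
  have : (comap Complex.im atTop).NeBot := atTop_neBot.comap_of_surj Complex.im_surjective
  obtain ⟨c, hc⟩ := (hφ₂.eventually_ne hL).exists
  have hc : f₂ c ≠ 0 := right_ne_zero_of_mul hc
  obtain ⟨g, hg, hg0, rfl⟩ := exists_differentiable_ne_zero_mul_eq h₁ h₂ hord hc
  have hone := (of_mul hg hg0 h₂ hc he₂ he₁).eq_of_tendsto hg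
    (tendsto_one_of_tendsto_mul hL hφ₁ hφ₂) (tendsto_one_of_tendsto_mul hL' hψ₁ hψ₂)
  funext z
  rw [Pi.mul_apply, hone, one_mul]

/-! ### The transform of a measure and the spectra -/

section InitialSolution

variable {T : ℝ} {p q : ℝ → ℂ}

theorem continuousOn_initialSolution (hT : 0 ≤ T) (hp : IntervalIntegrable p volume 0 T)
    (hq : IntervalIntegrable q volume 0 T) (μ a b : ℂ) :
    ContinuousOn (initialSolution T p q μ a b).1 (Icc 0 T) :=
  (initialSolution_spec hT hp hq μ a b).1.continuousOn

theorem differentiable_initialSolution (hT : 0 < T) (hp : IntervalIntegrable p volume 0 T)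
    (hq : IntervalIntegrable q volume 0 T) (a b : ℂ) {x : ℝ} (hx : x ∈ Icc 0 T) :
    Differentiable ℂ (fun μ => (initialSolution T p q μ a b).1 x) ∧
      Differentiable ℂ (fun μ => (initialSolution T p q μ a b).2 x) := by
  obtain ⟨Y, Z, hY, hZ, h⟩ := exists_initialSolution_family hT hp hq a b
  let e : C(Icc (0 : ℝ) T, ℂ) →L[ℂ] ℂ := ContinuousMap.evalCLM ℂ ⟨x, hx⟩
  rw [funext fun μ => (h μ ⟨x, hx⟩).1, funext fun μ => (h μ ⟨x, hx⟩).2]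
  exact ⟨e.differentiable.comp hY, e.differentiable.comp hZ⟩

theorem differentiable_measureForm_initialSolution (hT : 0 < T)
    (hp : IntervalIntegrable p volume 0 T) (hq : IntervalIntegrable q volume 0 T)
    (c : ComplexMeasure (Icc (0 : ℝ) T)) (a b : ℂ) :
    Differentiable ℂ fun μ => measureForm c (initialSolution T p q μ a b).1 := by
  obtain ⟨Y, Z, hY, -, h⟩ := exists_initialSolution_family hT hp hq a b
  simp only [measureForm, (h _ _).1]
  exact differentiable_complexMeasure_integral c hY

theorem differentiable_cauchyKernel (hT : 0 < T) (hp : IntervalIntegrable p volume 0 T)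
    (hq : IntervalIntegrable q volume 0 T) {t x : ℝ} (ht : t ∈ Icc 0 T) (hx : x ∈ Icc 0 T) :
    Differentiable ℂ (fun μ => cauchyKernel T p q μ t x) ∧
      Differentiable ℂ (fun μ => cauchyKernelDeriv T p q μ t x) := by
  have hX {s : ℝ} (hs : s ∈ Icc 0 T) (a b : ℂ) := differentiable_initialSolution hT hp hq a b hs
  exact ⟨((hX ht 1 0).1.mul (hX hx 0 1).1).sub ((hX ht 0 1).1.mul (hX hx 1 0).1),
    ((hX ht 1 0).1.mul (hX hx 0 1).2).sub ((hX ht 0 1).1.mul (hX hx 1 0).2)⟩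

theorem continuousOn_cauchyKernel_left (hT : 0 ≤ T) (hp : IntervalIntegrable p volume 0 T)
    (hq : IntervalIntegrable q volume 0 T) (μ : ℂ) (x : ℝ) :
    ContinuousOn (fun t => cauchyKernel T p q μ t x) (Icc 0 T) :=
  ((continuousOn_initialSolution hT hp hq μ 1 0).mul continuousOn_const).sub
    ((continuousOn_initialSolution hT hp hq μ 0 1).mul continuousOn_const)

theorem continuousOn_cauchyKernelDeriv_left (hT : 0 ≤ T) (hp : IntervalIntegrable p volume 0 T)
    (hq : IntervalIntegrable q volume 0 T) (μ : ℂ) (x : ℝ) :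
    ContinuousOn (fun t => cauchyKernelDeriv T p q μ t x) (Icc 0 T) :=
  ((continuousOn_initialSolution hT hp hq μ 1 0).mul continuousOn_const).sub
    ((continuousOn_initialSolution hT hp hq μ 0 1).mul continuousOn_const)

end InitialSolution

/-- The transform `∫ C(t, x) dc(t)` of a complex measure `c` by the Cauchy function `C`. As a
function of `x` it solves the pencil and lies in the kernel of `measureForm c`; its values at
`x = T` are the characteristic function of the problem with `y(T) = 0`. -/
noncomputable def cauchyTransform (T : ℝ) (p q : ℝ → ℂ) (c : ComplexMeasure (Icc (0 : ℝ) T))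
    (μ : ℂ) (x : ℝ) : ℂ :=
  measureForm c fun t => cauchyKernel T p q μ t x

/-- The derivative of `cauchyTransform` in `x`. -/
noncomputable def cauchyTransformDeriv (T : ℝ) (p q : ℝ → ℂ)
    (c : ComplexMeasure (Icc (0 : ℝ) T)) (μ : ℂ) (x : ℝ) : ℂ :=
  measureForm c fun t => cauchyKernelDeriv T p q μ t x

section Transform

variable {T : ℝ} {p p' q : ℝ → ℂ} (c : ComplexMeasure (Icc (0 : ℝ) T))

theorem cauchyTransform_eq (hT : 0 ≤ T) (hp : IntervalIntegrable p volume 0 T)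
    (hq : IntervalIntegrable q volume 0 T) (μ : ℂ) (x : ℝ) :
    cauchyTransform T p q c μ x =
      (initialSolution T p q μ 0 1).1 x * measureForm c (initialSolution T p q μ 1 0).1 +
      -(initialSolution T p q μ 1 0).1 x * measureForm c (initialSolution T p q μ 0 1).1 := by
  rw [← measureForm_combination c (continuousOn_initialSolution hT hp hq μ 1 0)
    (continuousOn_initialSolution hT hp hq μ 0 1), cauchyTransform]
  congr 1
  ext t
  simp only [cauchyKernel]
  ring

theorem cauchyTransformDeriv_eq (hT : 0 ≤ T) (hp : IntervalIntegrable p volume 0 T)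
    (hq : IntervalIntegrable q volume 0 T) (μ : ℂ) (x : ℝ) :
    cauchyTransformDeriv T p q c μ x =
      (initialSolution T p q μ 0 1).2 x * measureForm c (initialSolution T p q μ 1 0).1 +
      -(initialSolution T p q μ 1 0).2 x * measureForm c (initialSolution T p q μ 0 1).1 := by
  rw [← measureForm_combination c (continuousOn_initialSolution hT hp hq μ 1 0)
    (continuousOn_initialSolution hT hp hq μ 0 1), cauchyTransformDeriv]
  congr 1
  ext t
  simp only [cauchyKernelDeriv]
  ring

theorem pencilSolution_cauchyTransform (hT : 0 ≤ T) (hp : IntervalIntegrable p volume 0 T)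
    (hq : IntervalIntegrable q volume 0 T) (μ : ℂ) :
    PencilSolution T p q μ (cauchyTransform T p q c μ) (cauchyTransformDeriv T p q c μ) := by
  convert (initialSolution_spec hT hp hq μ 0 1).1.combination
    (initialSolution_spec hT hp hq μ 1 0).1 (measureForm c (initialSolution T p q μ 1 0).1)
    (-measureForm c (initialSolution T p q μ 0 1).1) using 1
  · ext x; rw [cauchyTransform_eq c hT hp hq]; ring
  · ext x; rw [cauchyTransformDeriv_eq c hT hp hq]; ring

theorem differentiable_cauchyTransform (hT : 0 < T) (hp : IntervalIntegrable p volume 0 T)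
    (hq : IntervalIntegrable q volume 0 T) {x : ℝ} (hx : x ∈ Icc 0 T) :
    Differentiable ℂ (fun μ => cauchyTransform T p q c μ x) := by
  simp only [cauchyTransform_eq c hT.le hp hq]
  have hU := differentiable_measureForm_initialSolution hT hp hq c
  have hX := fun a b => (differentiable_initialSolution hT hp hq a b hx).1
  exact ((hX 0 1).mul (hU 1 0)).add ((hX 1 0).neg.mul (hU 0 1))

theorem differentiable_cauchyTransformDeriv (hT : 0 < T) (hp : IntervalIntegrable p volume 0 T)
    (hq : IntervalIntegrable q volume 0 T) {x : ℝ} (hx : x ∈ Icc 0 T) :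
    Differentiable ℂ (fun μ => cauchyTransformDeriv T p q c μ x) := by
  simp only [cauchyTransformDeriv_eq c hT.le hp hq]
  have hU := differentiable_measureForm_initialSolution hT hp hq c
  have hX := fun a b => (differentiable_initialSolution hT hp hq a b hx).2
  exact ((hX 0 1).mul (hU 1 0)).add ((hX 1 0).neg.mul (hU 0 1))

theorem exists_norm_cauchyTransform_truncatedMeasure_le (hT : 0 < T) (hp : HasACDeriv T p p')
    (hq : IntervalIntegrable q volume 0 T) :
    ∃ K : ℝ, 1 ≤ K ∧ ∀ μ : ℂ, K ≤ ‖μ‖ → ∀ x ∈ Icc 0 T,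
      (∀ a ≤ 2 * x, ‖cauchyTransform T p q (truncatedMeasure c a) μ x‖ ≤
        K * Real.exp (|μ.im| * x) / ‖μ‖) ∧
      ‖cauchyTransformDeriv T p q (truncatedMeasure c x) μ x‖ ≤ K * Real.exp (|μ.im| * x) := by
  obtain ⟨K, hK, h⟩ := exists_norm_cauchyKernel_le hT hp hq
  set V := ‖ContinuousLinearMap.mul ℝ ℂ‖ * c.variation.real univ
  have hV : 0 ≤ V := by positivity
  have hKV : K ≤ K * (1 + V) := le_mul_of_one_le_right (by linarith) (by linarith)
  have hKV' : K * V ≤ K * (1 + V) := by gcongr; linarith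
  refine ⟨K * (1 + V), hK.trans hKV, fun μ hμ x hx => ⟨fun a ha => ?_, ?_⟩⟩
  · calc _ ≤ K * Real.exp (|μ.im| * x) / ‖μ‖ * V := by
          refine norm_measureForm_truncatedMeasure_le c (by positivity) fun t ht hta => ?_
          rcases le_total t x with htx | htx
          · refine (h μ (hKV.trans hμ) t ht x ⟨htx, hx.2⟩).1.trans ?_
            gcongr
            linarith [ht.1]
          · rw [cauchyKernel_swap, norm_neg]
            refine (h μ (hKV.trans hμ) x hx t ⟨htx, ht.2⟩).1.trans ?_
            gcongr
            linarith
      _ = K * V * Real.exp (|μ.im| * x) / ‖μ‖ := by ring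
      _ ≤ _ := by gcongr
  · calc _ ≤ K * Real.exp (|μ.im| * x) * V := by
          refine norm_measureForm_truncatedMeasure_le c (by positivity) fun t ht htx => ?_
          refine (h μ (hKV.trans hμ) t ht x ⟨htx, hx.2⟩).2.trans ?_
          gcongr
          linarith [ht.1]
      _ = K * V * Real.exp (|μ.im| * x) := by ring
      _ ≤ _ := by gcongr

theorem exists_norm_cauchyKernel_mul_exp_le (hT : 0 < T) (hp : HasACDeriv T p p')
    (hq : IntervalIntegrable q volume 0 T) :
    ∃ C : ℝ, ∀ᶠ μ in comap Complex.im atTop, ∀ a ∈ Icc 0 T, ∀ t ∈ Icc 0 T, t ≤ a →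
      ‖μ * Complex.exp (Complex.I * pencilPhase p μ a) * cauchyKernel T p q μ t a‖ ≤
        C * Real.exp (-(t * μ.im)) ∧
      ‖Complex.exp (Complex.I * pencilPhase p μ a) * cauchyKernelDeriv T p q μ t a‖ ≤
        C * Real.exp (-(t * μ.im)) := by
  have hpi : IntervalIntegrable p volume 0 T := hp.ac.continuousOn.intervalIntegrable
  obtain ⟨K, hK, h⟩ := exists_norm_cauchyKernel_le hT hp hq
  set K₀ := Real.exp (∫ u in (0 : ℝ)..T, ‖p u‖)
  refine ⟨K₀ * K, ?_⟩
  filter_upwards [tendsto_norm_comap_im.eventually_ge_atTop K,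
    tendsto_comap.eventually_ge_atTop 0] with μ hμ him a ha t ht hta
  have hphase := norm_exp_I_mul_pencilPhase_le hpi μ ha
  have hμ0 : 0 < ‖μ‖ := by linarith
  obtain ⟨hker, hderiv⟩ := h μ hμ t ht a ⟨hta, ha.2⟩
  have hexp : Real.exp (-(t * μ.im)) =
      Real.exp (-(a * μ.im)) * Real.exp (|μ.im| * (a - t)) := by
    rw [← Real.exp_add, abs_of_nonneg him]
    congr 1
    ring
  rw [hexp, norm_mul, norm_mul, norm_mul]
  constructor
  · calc _ ≤ ‖μ‖ * (K₀ * Real.exp (-(a * μ.im))) * (K * Real.exp (|μ.im| * (a - t)) / ‖μ‖) := by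
          gcongr
      _ = _ := by field_simp
  · calc _ ≤ K₀ * Real.exp (-(a * μ.im)) * (K * Real.exp (|μ.im| * (a - t))) := by gcongr
      _ = _ := by ring

theorem tendsto_cauchyTransform_truncatedMeasure (hT : 0 < T) (hp : HasACDeriv T p p')
    (hq : IntervalIntegrable q volume 0 T) {a : ℝ} (ha : a ∈ Ioc 0 T) :
    Tendsto (fun μ => μ * Complex.exp (Complex.I * pencilPhase p μ a) *
        cauchyTransform T p q (truncatedMeasure c a) μ a)
      (comap Complex.im atTop) (𝓝 (Complex.I / 2 * c {⟨0, le_rfl, hT.le⟩})) := by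
  have hpi : IntervalIntegrable p volume 0 T := hp.ac.continuousOn.intervalIntegrable
  have hcont := fun μ => continuousOn_cauchyKernel_left hT.le hpi hq μ a
  obtain ⟨C, hC⟩ := exists_norm_cauchyKernel_mul_exp_le hT hp hq
  simp only [cauchyTransform, ← measureForm_const_mul _ (hcont _)]
  refine tendsto_measureForm_truncatedMeasure c hT.le ha.1.le
    (f := fun μ t => _ * _) (fun μ => continuousOn_const.mul (hcont μ))
    (hC.mono fun μ h t ht hta => (h a (Ioc_subset_Icc_self ha) t ht hta).1)
    ((tendsto_mul_cauchyKernel_zero_mul_exp hT hp hq ha).congr fun μ => by ring)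

theorem tendsto_cauchyTransformDeriv_truncatedMeasure (hT : 0 < T) (hp : HasACDeriv T p p')
    (hq : IntervalIntegrable q volume 0 T) {a : ℝ} (ha : a ∈ Ioc 0 T) :
    Tendsto (fun μ => Complex.exp (Complex.I * pencilPhase p μ a) *
        cauchyTransformDeriv T p q (truncatedMeasure c a) μ a)
      (comap Complex.im atTop) (𝓝 (1 / 2 * c {⟨0, le_rfl, hT.le⟩})) := by
  have hpi : IntervalIntegrable p volume 0 T := hp.ac.continuousOn.intervalIntegrable
  have hcont := fun μ => continuousOn_cauchyKernelDeriv_left hT.le hpi hq μ a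
  obtain ⟨C, hC⟩ := exists_norm_cauchyKernel_mul_exp_le hT hp hq
  simp only [cauchyTransformDeriv, ← measureForm_const_mul _ (hcont _)]
  refine tendsto_measureForm_truncatedMeasure c hT.le ha.1.le
    (f := fun μ t => _ * _) (fun μ => continuousOn_const.mul (hcont μ))
    (hC.mono fun μ h t ht hta => (h a (Ioc_subset_Icc_self ha) t ht hta).2)
    ((tendsto_cauchyKernelDeriv_zero_mul_exp hT hp hq ha).congr fun μ => by ring)

end Transform

section Spectrum

variable {T : ℝ} {p q : ℝ → ℂ}

theorem PencilSolution.exists_ne_zero {μ : ℂ} {y z : ℝ → ℂ} (hT : 0 < T)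
    (h : PencilSolution T p q μ y z) (h0 : y 0 ≠ 0 ∨ z 0 ≠ 0) : ∃ x ∈ Icc 0 T, y x ≠ 0 := by
  by_contra! hy
  have hm : (0 : ℝ) ∈ Icc 0 T := ⟨le_rfl, hT.le⟩
  have hz : z 0 = 0 := (uniqueDiffOn_Icc hT 0 hm).eq_deriv _ (h.hasDeriv 0 hm)
    ((hasDerivWithinAt_const 0 _ (0 : ℂ)).congr hy (hy 0 hm))
  exact h0.elim (fun h => h (hy 0 hm)) fun h => h hz

variable (c : ComplexMeasure (Icc (0 : ℝ) T))

theorem IsPencilEigenvalue.of_characteristicFunction_eq_zero (hT : 0 < T)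
    (hp : IntervalIntegrable p volume 0 T) (hq : IntervalIntegrable q volume 0 T)
    (V : (ℝ → ℂ) × (ℝ → ℂ) →ₗ[ℂ] ℂ) {μ : ℂ}
    (h : characteristicFunction T p q (measureForm c) V μ = 0) :
    IsPencilEigenvalue T p q (measureForm c) V μ := by
  obtain ⟨v, hv, hv0⟩ := Matrix.exists_vecMul_eq_zero_iff.2 h
  obtain ⟨h1, e1, e1'⟩ := initialSolution_spec hT.le hp hq μ 1 0
  obtain ⟨h2, e2, e2'⟩ := initialSolution_spec hT.le hp hq μ 0 1
  have hU := congrFun hv0 0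
  have hV := congrFun hv0 1
  simp only [Matrix.vecMul, dotProduct, Fin.sum_univ_two, Matrix.of_apply, Matrix.cons_val',
    Matrix.cons_val_zero, Matrix.cons_val_one, Matrix.cons_val_fin_one, Pi.zero_apply] at hU hV
  have hs := h1.combination h2 (v 0) (v 1)
  refine ⟨_, _, hs, hs.exists_ne_zero hT ?_, ?_, ?_⟩
  · simp only [e1, e1', e2, e2', mul_one, mul_zero, add_zero, zero_add]
    by_contra! hvv
    exact hv (by ext i; fin_cases i; exacts [hvv.1, hvv.2])
  · rwa [measureForm_combination c h1.continuousOn h2.continuousOn]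
  · rwa [← smul_eq_mul, ← smul_eq_mul, ← map_smul, ← map_smul, ← map_add] at hV

theorem spectrumMultiplicity_eq_analyticOrderAt (hT : 0 < T)
    (hp : IntervalIntegrable p volume 0 T) (hq : IntervalIntegrable q volume 0 T)
    (V : (ℝ → ℂ) × (ℝ → ℂ) →ₗ[ℂ] ℂ) (μ : ℂ) :
    spectrumMultiplicity T p q (measureForm c) V μ =
      analyticOrderAt (characteristicFunction T p q (measureForm c) V) μ := by
  rw [spectrumMultiplicity]
  split_ifs with h
  · rfl
  · exact (analyticOrderAt_eq_zero.2 (.inr fun h0 =>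
      h (.of_characteristicFunction_eq_zero c hT hp hq V h0))).symm

theorem spectrumMultiplicity_eval_eq (hT : 0 < T)
    (hp : IntervalIntegrable p volume 0 T) (hq : IntervalIntegrable q volume 0 T) (μ : ℂ) :
    spectrumMultiplicity T p q (measureForm c) (fun Y => Y.1 T) μ =
      analyticOrderAt (fun μ => cauchyTransform T p q c μ T) μ := by
  have h : characteristicFunction T p q (measureForm c) (fun Y => Y.1 T) =
      fun μ => cauchyTransform T p q c μ T := by
    funext μ
    rw [cauchyTransform_eq c hT.le hp hq, characteristicFunction, Matrix.det_fin_two_of]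
    ring
  rw [← h]
  exact spectrumMultiplicity_eq_analyticOrderAt c hT hp hq (.proj T ∘ₗ .fst ℂ _ _) μ

theorem spectrumMultiplicity_eval_deriv_eq (hT : 0 < T)
    (hp : IntervalIntegrable p volume 0 T) (hq : IntervalIntegrable q volume 0 T) (μ : ℂ) :
    spectrumMultiplicity T p q (measureForm c) (fun Y => Y.2 T) μ =
      analyticOrderAt (fun μ => cauchyTransformDeriv T p q c μ T) μ := by
  have h : characteristicFunction T p q (measureForm c) (fun Y => Y.2 T) =
      fun μ => cauchyTransformDeriv T p q c μ T := by
    funext μ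
    rw [cauchyTransformDeriv_eq c hT.le hp hq, characteristicFunction, Matrix.det_fin_two_of]
    ring
  rw [← h]
  exact spectrumMultiplicity_eq_analyticOrderAt c hT hp hq (.proj T ∘ₗ .snd ℂ _ _) μ

end Spectrum

section Negation

variable {T : ℝ}

theorem HasACDeriv.neg {f f' : ℝ → ℂ} (hf : HasACDeriv T f f') :
    HasACDeriv T (fun x => -f x) (fun x => -f' x) := by
  simpa using hf.const_mul (-1)

theorem initialSolution_neg (T : ℝ) (p q : ℝ → ℂ) (μ a b : ℂ) :
    initialSolution T (fun x => -p x) q (-μ) a b = initialSolution T p q μ a b := by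
  have h (y z : ℝ → ℂ) :
      PencilSolution T (fun x => -p x) q (-μ) y z ↔ PencilSolution T p q μ y z := by
    have e (x : ℝ) : -(((-μ) ^ 2 - 2 * (-μ) * (-p x) - q x) * y x) =
        -((μ ^ 2 - 2 * μ * p x - q x) * y x) := by ring
    exact ⟨fun h => ⟨h.hasDeriv, h.absCont, by simpa only [e] using h.equation⟩,
      fun h => ⟨h.hasDeriv, h.absCont, by simpa only [e] using h.equation⟩⟩
  simp only [initialSolution, h]

theorem cauchyKernel_neg (T : ℝ) (p q : ℝ → ℂ) (μ : ℂ) (t x : ℝ) :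
    cauchyKernel T (fun x => -p x) q (-μ) t x = cauchyKernel T p q μ t x := by
  simp only [cauchyKernel, initialSolution_neg]

theorem cauchyTransform_neg (p q : ℝ → ℂ) (c : ComplexMeasure (Icc (0 : ℝ) T)) (μ : ℂ) (x : ℝ) :
    cauchyTransform T (fun x => -p x) q c (-μ) x = cauchyTransform T p q c μ x := by
  simp only [cauchyTransform, cauchyKernel_neg]

theorem cauchyTransformDeriv_neg (p q : ℝ → ℂ) (c : ComplexMeasure (Icc (0 : ℝ) T)) (μ : ℂ)
    (x : ℝ) :
    cauchyTransformDeriv T (fun x => -p x) q c (-μ) x = cauchyTransformDeriv T p q c μ x := by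
  simp only [cauchyTransformDeriv, cauchyKernelDeriv, initialSolution_neg]

theorem pencilPhase_neg (p : ℝ → ℂ) (μ : ℂ) (x : ℝ) :
    pencilPhase (fun x => -p x) (-μ) x = -pencilPhase p μ x := by
  simp only [pencilPhase, intervalIntegral.integral_neg]
  ring

theorem tendsto_neg_comap_im_atBot :
    Tendsto (fun μ : ℂ => -μ) (comap Complex.im atBot) (comap Complex.im atTop) := by
  rw [tendsto_comap_iff]
  exact (tendsto_neg_atBot_atTop.comp tendsto_comap).congr fun μ => by simp

end Negation

section TransformEq

variable {T a : ℝ} {p p' q r r' s : ℝ → ℂ} (c : ComplexMeasure (Icc (0 : ℝ) T))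

theorem tendsto_cauchyTransform_truncatedMeasure_atBot (hT : 0 < T) (hp : HasACDeriv T p p')
    (hq : IntervalIntegrable q volume 0 T) (ha : a ∈ Ioc 0 T) :
    Tendsto (fun μ => -μ * Complex.exp (-(Complex.I * pencilPhase p μ a)) *
        cauchyTransform T p q (truncatedMeasure c a) μ a)
      (comap Complex.im atBot) (𝓝 (Complex.I / 2 * c {⟨0, le_rfl, hT.le⟩})) := by
  refine ((tendsto_cauchyTransform_truncatedMeasure c hT hp.neg hq ha).comp
    tendsto_neg_comap_im_atBot).congr fun μ => ?_
  simp only [Function.comp_apply, cauchyTransform_neg, pencilPhase_neg, mul_neg]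

theorem tendsto_cauchyTransformDeriv_truncatedMeasure_atBot (hT : 0 < T) (hp : HasACDeriv T p p')
    (hq : IntervalIntegrable q volume 0 T) (ha : a ∈ Ioc 0 T) :
    Tendsto (fun μ => Complex.exp (-(Complex.I * pencilPhase p μ a)) *
        cauchyTransformDeriv T p q (truncatedMeasure c a) μ a)
      (comap Complex.im atBot) (𝓝 (1 / 2 * c {⟨0, le_rfl, hT.le⟩})) := by
  refine ((tendsto_cauchyTransformDeriv_truncatedMeasure c hT hp.neg hq ha).comp
    tendsto_neg_comap_im_atBot).congr fun μ => ?_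
  simp only [Function.comp_apply, cauchyTransformDeriv_neg, pencilPhase_neg, mul_neg]

theorem isExpType_cauchyTransform (hT : 0 < T) (hp : HasACDeriv T p p')
    (hq : IntervalIntegrable q volume 0 T) (ha : a ∈ Icc 0 T) :
    IsExpType fun μ => cauchyTransform T p q (truncatedMeasure c a) μ a := by
  have hpi : IntervalIntegrable p volume 0 T := hp.ac.continuousOn.intervalIntegrable
  obtain ⟨K, hK, h⟩ := exists_norm_cauchyTransform_truncatedMeasure_le c hT hp hq
  refine .of_norm_le_exp_im (differentiable_cauchyTransform _ hT hpi hq ha).continuous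
    ha.1 fun μ hμ => ((h μ hμ a ha).1 a (by linarith [ha.1])).trans ?_
  exact div_le_self (by positivity) (hK.trans hμ)

theorem isExpType_cauchyTransformDeriv (hT : 0 < T) (hp : HasACDeriv T p p')
    (hq : IntervalIntegrable q volume 0 T) (ha : a ∈ Icc 0 T) :
    IsExpType fun μ => cauchyTransformDeriv T p q (truncatedMeasure c a) μ a := by
  have hpi : IntervalIntegrable p volume 0 T := hp.ac.continuousOn.intervalIntegrable
  obtain ⟨K, -, h⟩ := exists_norm_cauchyTransform_truncatedMeasure_le c hT hp hq
  exact .of_norm_le_exp_im (differentiable_cauchyTransformDeriv _ hT hpi hq ha).continuous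
    ha.1 fun μ hμ => (h μ hμ a ha).2

theorem pencilPhase_eq_of_integral_eq
    (hint : ∫ x in (0 : ℝ)..a, p x = ∫ x in (0 : ℝ)..a, r x) (μ : ℂ) :
    pencilPhase r μ a = pencilPhase p μ a := by
  simp only [pencilPhase, hint]

theorem cauchyTransform_eq_of_analyticOrderAt_eq (hT : 0 < T) (hp : HasACDeriv T p p')
    (hq : IntervalIntegrable q volume 0 T) (hr : HasACDeriv T r r')
    (hs : IntervalIntegrable s volume 0 T) (hc : c {⟨0, le_rfl, hT.le⟩} ≠ 0) (ha : a ∈ Ioc 0 T)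
    (hint : ∫ x in (0 : ℝ)..a, p x = ∫ x in (0 : ℝ)..a, r x)
    (hord : ∀ z, analyticOrderAt (fun μ => cauchyTransform T p q (truncatedMeasure c a) μ a) z =
      analyticOrderAt (fun μ => cauchyTransform T r s (truncatedMeasure c a) μ a) z) :
    (fun μ => cauchyTransform T p q (truncatedMeasure c a) μ a) =
      fun μ => cauchyTransform T r s (truncatedMeasure c a) μ a := by
  have hpi : IntervalIntegrable p volume 0 T := hp.ac.continuousOn.intervalIntegrable
  have hri : IntervalIntegrable r volume 0 T := hr.ac.continuousOn.intervalIntegrable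
  have hx := Ioc_subset_Icc_self ha
  have htop := tendsto_cauchyTransform_truncatedMeasure c hT hr hs ha
  have hbot := tendsto_cauchyTransform_truncatedMeasure_atBot c hT hr hs ha
  simp only [pencilPhase_eq_of_integral_eq hint] at htop hbot
  have hL : Complex.I / 2 * c {⟨0, le_rfl, hT.le⟩} ≠ 0 := by simp [hc]
  exact IsExpType.eq_of_analyticOrderAt_eq (differentiable_cauchyTransform _ hT hpi hq hx)
    (differentiable_cauchyTransform _ hT hri hs hx) (isExpType_cauchyTransform c hT hp hq hx)
    (isExpType_cauchyTransform c hT hr hs hx) hord hL hL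
    (tendsto_cauchyTransform_truncatedMeasure c hT hp hq ha) htop
    (tendsto_cauchyTransform_truncatedMeasure_atBot c hT hp hq ha) hbot

theorem cauchyTransformDeriv_eq_of_analyticOrderAt_eq (hT : 0 < T) (hp : HasACDeriv T p p')
    (hq : IntervalIntegrable q volume 0 T) (hr : HasACDeriv T r r')
    (hs : IntervalIntegrable s volume 0 T) (hc : c {⟨0, le_rfl, hT.le⟩} ≠ 0) (ha : a ∈ Ioc 0 T)
    (hint : ∫ x in (0 : ℝ)..a, p x = ∫ x in (0 : ℝ)..a, r x)
    (hord : ∀ z,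
      analyticOrderAt (fun μ => cauchyTransformDeriv T p q (truncatedMeasure c a) μ a) z =
        analyticOrderAt (fun μ => cauchyTransformDeriv T r s (truncatedMeasure c a) μ a) z) :
    (fun μ => cauchyTransformDeriv T p q (truncatedMeasure c a) μ a) =
      fun μ => cauchyTransformDeriv T r s (truncatedMeasure c a) μ a := by
  have hpi : IntervalIntegrable p volume 0 T := hp.ac.continuousOn.intervalIntegrable
  have hri : IntervalIntegrable r volume 0 T := hr.ac.continuousOn.intervalIntegrable
  have hx := Ioc_subset_Icc_self ha
  have htop := tendsto_cauchyTransformDeriv_truncatedMeasure c hT hr hs ha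
  have hbot := tendsto_cauchyTransformDeriv_truncatedMeasure_atBot c hT hr hs ha
  simp only [pencilPhase_eq_of_integral_eq hint] at htop hbot
  have hL : 1 / 2 * c {⟨0, le_rfl, hT.le⟩} ≠ 0 := by simp [hc]
  exact IsExpType.eq_of_analyticOrderAt_eq (differentiable_cauchyTransformDeriv _ hT hpi hq hx)
    (differentiable_cauchyTransformDeriv _ hT hri hs hx)
    (isExpType_cauchyTransformDeriv c hT hp hq hx) (isExpType_cauchyTransformDeriv c hT hr hs hx)
    hord hL hL (tendsto_cauchyTransformDeriv_truncatedMeasure c hT hp hq ha) htop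
    (tendsto_cauchyTransformDeriv_truncatedMeasure_atBot c hT hp hq ha) hbot

end TransformEq

/-! ### Recovery of the coefficients on `[a / 2, a]` -/

/-- The mixed second derivative of the Cauchy function, that is, the derivative of
`cauchyKernelDeriv` in its first variable. -/
noncomputable def cauchyKernelMixedDeriv (T : ℝ) (p q : ℝ → ℂ) (μ : ℂ) (t x : ℝ) : ℂ :=
  (initialSolution T p q μ 1 0).2 t * (initialSolution T p q μ 0 1).2 x -
    (initialSolution T p q μ 0 1).2 t * (initialSolution T p q μ 1 0).2 x

/-- For every spectral parameter, the pencils with coefficients `(p, q)` and `(r, s)` assign to the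
part of `c` on `[0, a]` transforms with the same Cauchy data at `a`. This is the information on the
coefficients that is passed from `a = T` down to smaller `a`. -/
def TransformsAgreeAt {T : ℝ} (p q r s : ℝ → ℂ) (c : ComplexMeasure (Icc (0 : ℝ) T)) (a : ℝ) :
    Prop :=
  ∀ μ, cauchyTransform T p q (truncatedMeasure c a) μ a =
      cauchyTransform T r s (truncatedMeasure c a) μ a ∧
    cauchyTransformDeriv T p q (truncatedMeasure c a) μ a =
      cauchyTransformDeriv T r s (truncatedMeasure c a) μ a

section Transport

variable {T a x : ℝ} {p q r s : ℝ → ℂ} {μ : ℂ} {y z y' z' : ℝ → ℂ}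

theorem cauchyKernelMixedDeriv_self (μ : ℂ) (x : ℝ) : cauchyKernelMixedDeriv T p q μ x x = 0 := by
  simp only [cauchyKernelMixedDeriv]
  ring

theorem pencilSolution_cauchyKernelDeriv (hT : 0 ≤ T) (hp : IntervalIntegrable p volume 0 T)
    (hq : IntervalIntegrable q volume 0 T) (μ : ℂ) (x : ℝ) :
    PencilSolution T p q μ (fun t => cauchyKernelDeriv T p q μ t x)
      (fun t => cauchyKernelMixedDeriv T p q μ t x) := by
  convert (initialSolution_spec hT hp hq μ 1 0).1.combination
    (initialSolution_spec hT hp hq μ 0 1).1 ((initialSolution T p q μ 0 1).2 x)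
    (-(initialSolution T p q μ 1 0).2 x) using 1
  · ext t; simp only [cauchyKernelDeriv]; ring
  · ext t; simp only [cauchyKernelMixedDeriv]; ring

theorem PencilSolution.eq_cauchyKernel (hT : 0 < T) (hp : IntervalIntegrable p volume 0 T)
    (hq : IntervalIntegrable q volume 0 T) (h : PencilSolution T p q μ y z) (ha : a ∈ Icc 0 T)
    (hx : x ∈ Icc 0 T) :
    y x = y a * cauchyKernelDeriv T p q μ x a - z a * cauchyKernel T p q μ x a := by
  have hW := h.wronskian_eq hT hp hq (pencilSolution_cauchyKernel hT.le hp hq μ x) hx ha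
  rw [cauchyKernel_self, cauchyKernelDeriv_self hT hp hq μ hx] at hW
  linear_combination hW

theorem PencilSolution.eqOn_of_ae_eq (hT : 0 < T) (hp : IntervalIntegrable p volume 0 T)
    (hq : IntervalIntegrable q volume 0 T) (hr : IntervalIntegrable r volume 0 T)
    (hs : IntervalIntegrable s volume 0 T) (h : PencilSolution T p q μ y z)
    (h' : PencilSolution T r s μ y' z') (hy : y T = y' T) (hz : z T = z' T) (ha : 0 ≤ a)
    (hpr : ∀ᵐ x ∂(volume.restrict (Ioo a T)), p x = r x)
    (hqs : ∀ᵐ x ∂(volume.restrict (Ioo a T)), q x = s x) :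
    EqOn y y' (Icc a T) ∧ EqOn z z' (Icc a T) := by
  have hW {x : ℝ} (hx : x ∈ Icc a T) {u v : ℝ → ℂ} (huv : PencilSolution T r s μ u v) :
      y x * v x - z x * u x = y' x * v x - z' x * u x := by
    rw [h.wronskian_eq_of_ae_eq hT ha hp hq hr hs huv hpr hqs hx ⟨hx.1.trans hx.2, le_rfl⟩, hy, hz,
      h'.wronskian_eq hT hr hs huv ⟨ha.trans hx.1, hx.2⟩ ⟨hT.le, le_rfl⟩]
  constructor <;> intro x hx <;>
    have hD := cauchyKernelDeriv_self hT hr hs μ (Icc_subset_Icc_left ha hx)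
  · have hC := hW hx (pencilSolution_cauchyKernel hT.le hr hs μ x)
    rw [cauchyKernel_self, hD] at hC
    linear_combination hC
  · have hC := hW hx (pencilSolution_cauchyKernelDeriv hT.le hr hs μ x)
    simp only [cauchyKernelMixedDeriv_self, hD] at hC
    linear_combination -hC

theorem cauchyKernel_eqOn_of_ae_eq (hT : 0 < T) (hp : IntervalIntegrable p volume 0 T)
    (hq : IntervalIntegrable q volume 0 T) (hr : IntervalIntegrable r volume 0 T)
    (hs : IntervalIntegrable s volume 0 T) (ha : 0 ≤ a)
    (hpr : ∀ᵐ x ∂(volume.restrict (Ioo a T)), p x = r x)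
    (hqs : ∀ᵐ x ∂(volume.restrict (Ioo a T)), q x = s x) (μ : ℂ) :
    EqOn (fun t => cauchyKernel T p q μ t T) (fun t => cauchyKernel T r s μ t T) (Icc a T) ∧
      EqOn (fun t => cauchyKernelDeriv T p q μ t T) (fun t => cauchyKernelDeriv T r s μ t T)
        (Icc a T) := by
  have hTT : T ∈ Icc 0 T := ⟨hT.le, le_rfl⟩
  have hD : cauchyKernelDeriv T p q μ T T = cauchyKernelDeriv T r s μ T T := by
    rw [cauchyKernelDeriv_self hT hp hq μ hTT, cauchyKernelDeriv_self hT hr hs μ hTT]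
  constructor
  · simp only [cauchyKernel_swap μ _ T]
    exact fun t ht => congrArg Neg.neg
      (((pencilSolution_cauchyKernel hT.le hp hq μ T).eqOn_of_ae_eq hT hp hq hr hs
        (pencilSolution_cauchyKernel hT.le hr hs μ T) (by simp only [cauchyKernel_self]) hD
        ha hpr hqs).1 ht)
  · exact ((pencilSolution_cauchyKernelDeriv hT.le hp hq μ T).eqOn_of_ae_eq hT hp hq hr hs
      (pencilSolution_cauchyKernelDeriv hT.le hr hs μ T) hD
      (by simp only [cauchyKernelMixedDeriv_self]) ha hpr hqs).1

variable {c : ComplexMeasure (Icc (0 : ℝ) T)}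

theorem TransformsAgreeAt.of_ae_eq (hT : 0 < T) (hp : IntervalIntegrable p volume 0 T)
    (hq : IntervalIntegrable q volume 0 T) (hr : IntervalIntegrable r volume 0 T)
    (hs : IntervalIntegrable s volume 0 T) (h : TransformsAgreeAt p q r s c T)
    (ha : a ∈ Icc 0 T) (hpr : ∀ᵐ x ∂(volume.restrict (Ioo a T)), p x = r x)
    (hqs : ∀ᵐ x ∂(volume.restrict (Ioo a T)), q x = s x) : TransformsAgreeAt p q r s c a := by
  intro μ
  obtain ⟨hC, hD⟩ := h μ
  rw [truncatedMeasure_self] at hC hD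
  obtain ⟨hK, hKD⟩ := cauchyKernel_eqOn_of_ae_eq hT hp hq hr hs ha.1 hpr hqs μ
  have hC_T := measureForm_truncatedMeasure_eq c (continuousOn_cauchyKernel_left hT.le hp hq μ T)
    (continuousOn_cauchyKernel_left hT.le hr hs μ T) hC hK
  have hD_T := measureForm_truncatedMeasure_eq c
    (continuousOn_cauchyKernelDeriv_left hT.le hp hq μ T)
    (continuousOn_cauchyKernelDeriv_left hT.le hr hs μ T) hD hKD
  exact ((pencilSolution_cauchyTransform _ hT.le hp hq μ).eqOn_of_ae_eq hT hp hq hr hs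
    (pencilSolution_cauchyTransform _ hT.le hr hs μ) hC_T hD_T ha.1 hpr hqs).imp
    (· ⟨le_rfl, ha.2⟩) (· ⟨le_rfl, ha.2⟩)

theorem TransformsAgreeAt.neg (h : TransformsAgreeAt p q r s c a) :
    TransformsAgreeAt (fun x => -p x) q (fun x => -r x) s c a := by
  intro μ
  rw [← neg_neg μ, cauchyTransform_neg, cauchyTransform_neg, cauchyTransformDeriv_neg,
    cauchyTransformDeriv_neg]
  exact h (-μ)

end Transport

/-- The Wronskian at `a` of the Cauchy functions `C(x, ·)` of the pencils with coefficients `(r, s)`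
and `(p, q)`. It vanishes identically if the two quotients `C' / C` coincide. -/
noncomputable def cauchyWronskian (T : ℝ) (p q r s : ℝ → ℂ) (μ : ℂ) (x a : ℝ) : ℂ :=
  cauchyKernelDeriv T p q μ x a * cauchyKernel T r s μ x a -
    cauchyKernel T p q μ x a * cauchyKernelDeriv T r s μ x a

section Halving

variable {T a x : ℝ} {p p' q r r' s : ℝ → ℂ} {c : ComplexMeasure (Icc (0 : ℝ) T)}

theorem cauchyWronskian_neg (T : ℝ) (p q r s : ℝ → ℂ) (μ : ℂ) (x a : ℝ) :
    cauchyWronskian T (fun x => -p x) q (fun x => -r x) s (-μ) x a =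
      cauchyWronskian T p q r s μ x a := by
  simp only [cauchyWronskian, cauchyKernel, cauchyKernelDeriv, initialSolution_neg]

theorem differentiable_cauchyWronskian (hT : 0 < T) (hp : IntervalIntegrable p volume 0 T)
    (hq : IntervalIntegrable q volume 0 T) (hr : IntervalIntegrable r volume 0 T)
    (hs : IntervalIntegrable s volume 0 T) (hx : x ∈ Icc 0 T) (ha : a ∈ Icc 0 T) :
    Differentiable ℂ fun μ => cauchyWronskian T p q r s μ x a := by
  obtain ⟨hC, hC'⟩ := differentiable_cauchyKernel hT hp hq hx ha
  obtain ⟨hD, hD'⟩ := differentiable_cauchyKernel hT hr hs hx ha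
  exact (hC'.mul hD).sub (hC.mul hD')

theorem isExpType_cauchyWronskian (hT : 0 < T) (hp : HasACDeriv T p p')
    (hq : IntervalIntegrable q volume 0 T) (hr : HasACDeriv T r r')
    (hs : IntervalIntegrable s volume 0 T) (ha : a ≤ T) (hx : x ∈ Icc 0 a) :
    IsExpType fun μ => cauchyWronskian T p q r s μ x a := by
  have hx' : x ∈ Icc 0 T := ⟨hx.1, hx.2.trans ha⟩
  obtain ⟨K₁, hK₁, h₁⟩ := exists_norm_cauchyKernel_le hT hp hq
  obtain ⟨K₂, hK₂, h₂⟩ := exists_norm_cauchyKernel_le hT hr hs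
  have hK₁' : K₁ ≤ 2 * K₁ * K₂ := by nlinarith
  have hK₂' : K₂ ≤ 2 * K₁ * K₂ := by nlinarith
  refine .of_norm_le_exp_im (differentiable_cauchyWronskian hT
    hp.ac.continuousOn.intervalIntegrable hq hr.ac.continuousOn.intervalIntegrable hs hx'
    ⟨hx.1.trans hx.2, ha⟩).continuous (K := 2 * K₁ * K₂) (B := 2 * (a - x)) (by linarith [hx.2])
    fun μ hμ => ?_
  have hμ1 : 1 ≤ ‖μ‖ := hK₁.trans (hK₁'.trans hμ)
  obtain ⟨hC₁, hD₁⟩ := h₁ μ (hK₁'.trans hμ) x hx' a ⟨hx.2, ha⟩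
  obtain ⟨hC₂, hD₂⟩ := h₂ μ (hK₂'.trans hμ) x hx' a ⟨hx.2, ha⟩
  replace hC₁ := hC₁.trans (div_le_self (by positivity) hμ1)
  replace hC₂ := hC₂.trans (div_le_self (by positivity) hμ1)
  have hexp : Real.exp (|μ.im| * (2 * (a - x))) =
      Real.exp (|μ.im| * (a - x)) * Real.exp (|μ.im| * (a - x)) := by
    rw [← Real.exp_add]
    congr 1
    ring
  rw [hexp]
  set Y := Real.exp (|μ.im| * (a - x))
  calc _ ≤ K₁ * Y * (K₂ * Y) + K₁ * Y * (K₂ * Y) := by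
        refine (norm_sub_le _ _).trans ?_
        simp only [norm_mul]
        gcongr
    _ = _ := by ring

theorem cauchyTransform_mul_cauchyWronskian (hT : 0 < T) (hp : IntervalIntegrable p volume 0 T)
    (hq : IntervalIntegrable q volume 0 T) (hr : IntervalIntegrable r volume 0 T)
    (hs : IntervalIntegrable s volume 0 T) (ha : a ∈ Icc 0 T) (hx : x ∈ Icc 0 T)
    (h : TransformsAgreeAt p q r s c a) (μ : ℂ) :
    cauchyTransform T p q (truncatedMeasure c a) μ a * cauchyWronskian T p q r s μ x a =
      cauchyTransform T p q (truncatedMeasure c a) μ x * cauchyKernel T r s μ x a -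
        cauchyKernel T p q μ x a * cauchyTransform T r s (truncatedMeasure c a) μ x := by
  rw [(pencilSolution_cauchyTransform _ hT.le hp hq μ).eq_cauchyKernel hT hp hq ha hx,
    (pencilSolution_cauchyTransform _ hT.le hr hs μ).eq_cauchyKernel hT hr hs ha hx,
    ← (h μ).1, ← (h μ).2, cauchyWronskian]
  ring

-- The transforms at `x` are `O(e ^ (|Im μ| x) / |μ|)` because `|x - t| ≤ x` for all `t ∈ [0, a]` as
-- soon as `a / 2 ≤ x`.
theorem exists_norm_cauchyTransform_mul_cauchyWronskian_le (hT : 0 < T) (hp : HasACDeriv T p p')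
    (hq : IntervalIntegrable q volume 0 T) (hr : HasACDeriv T r r')
    (hs : IntervalIntegrable s volume 0 T) (ha : a ∈ Icc 0 T) (h : TransformsAgreeAt p q r s c a)
    (hx : x ∈ Icc (a / 2) a) :
    ∃ K : ℝ, ∀ᶠ μ in comap Complex.im atTop,
      ‖cauchyTransform T p q (truncatedMeasure c a) μ a * cauchyWronskian T p q r s μ x a‖ ≤
        K * Real.exp (μ.im * a) / ‖μ‖ ^ 2 := by
  have hpi : IntervalIntegrable p volume 0 T := hp.ac.continuousOn.intervalIntegrable
  have hri : IntervalIntegrable r volume 0 T := hr.ac.continuousOn.intervalIntegrable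
  have hx0 : x ∈ Icc 0 T := ⟨by linarith [hx.1, ha.1], hx.2.trans ha.2⟩
  obtain ⟨K₁, hK₁, h₁⟩ := exists_norm_cauchyKernel_le hT hp hq
  obtain ⟨K₂, -, h₂⟩ := exists_norm_cauchyKernel_le hT hr hs
  obtain ⟨K₃, hK₃, h₃⟩ := exists_norm_cauchyTransform_truncatedMeasure_le c hT hp hq
  obtain ⟨K₄, -, h₄⟩ := exists_norm_cauchyTransform_truncatedMeasure_le c hT hr hs
  refine ⟨K₃ * K₂ + K₁ * K₄, ?_⟩
  have hlarge := tendsto_norm_comap_im.eventually_ge_atTop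
  filter_upwards [hlarge K₁, hlarge K₂, hlarge K₃, hlarge K₄,
    tendsto_comap.eventually_ge_atTop 0] with μ hμ₁ hμ₂ hμ₃ hμ₄ him
  have hC₁ := (h₁ μ hμ₁ x hx0 a ⟨hx.2, ha.2⟩).1
  have hC₂ := (h₂ μ hμ₂ x hx0 a ⟨hx.2, ha.2⟩).1
  have hθ₁ := (h₃ μ hμ₃ x hx0).1 a (by linarith [hx.1])
  have hθ₂ := (h₄ μ hμ₄ x hx0).1 a (by linarith [hx.1])
  rw [abs_of_nonneg him] at hC₁ hC₂ hθ₁ hθ₂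
  have hexp : Real.exp (μ.im * a) = Real.exp (μ.im * x) * Real.exp (μ.im * (a - x)) := by
    rw [← Real.exp_add]
    congr 1
    ring
  rw [cauchyTransform_mul_cauchyWronskian hT hpi hq hri hs ha hx0 h, hexp]
  set X := Real.exp (μ.im * x)
  set Y := Real.exp (μ.im * (a - x))
  calc _ ≤ K₃ * X / ‖μ‖ * (K₂ * Y / ‖μ‖) + K₁ * Y / ‖μ‖ * (K₄ * X / ‖μ‖) := by
        refine (norm_sub_le _ _).trans ?_
        rw [norm_mul, norm_mul]
        gcongr
    _ = _ := by ring

theorem tendsto_cauchyWronskian (hT : 0 < T) (hp : HasACDeriv T p p')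
    (hq : IntervalIntegrable q volume 0 T) (hr : HasACDeriv T r r')
    (hs : IntervalIntegrable s volume 0 T) (hc : c {⟨0, le_rfl, hT.le⟩} ≠ 0) (ha : a ∈ Ioc 0 T)
    (h : TransformsAgreeAt p q r s c a) (hx : x ∈ Icc (a / 2) a) :
    Tendsto (fun μ => cauchyWronskian T p q r s μ x a) (comap Complex.im atTop) (𝓝 0) := by
  have hpi : IntervalIntegrable p volume 0 T := hp.ac.continuousOn.intervalIntegrable
  have ha' := Ioc_subset_Icc_self ha
  obtain ⟨K, hK⟩ :=
    exists_norm_cauchyTransform_mul_cauchyWronskian_le hT hp hq hr hs ha' h hx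
  set K₀ := Real.exp (∫ u in (0 : ℝ)..T, ‖p u‖)
  set θ := fun μ => cauchyTransform T p q (truncatedMeasure c a) μ a
  set φ := fun μ => μ * Complex.exp (Complex.I * pencilPhase p μ a)
  have hφθ : Tendsto (fun μ => φ μ * θ μ) _ _ :=
    tendsto_cauchyTransform_truncatedMeasure c hT hp hq ha
  have hL : Complex.I / 2 * c {⟨0, le_rfl, hT.le⟩} ≠ 0 := by simp [hc]
  have hnum : Tendsto (fun μ => φ μ * (θ μ * cauchyWronskian T p q r s μ x a))
      (comap Complex.im atTop) (𝓝 0) := by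
    refine squeeze_zero_norm' (a := fun μ => K₀ * K / ‖μ‖) ?_
      (tendsto_norm_comap_im.const_div_atTop _)
    filter_upwards [hK, tendsto_norm_comap_im.eventually_gt_atTop 0] with μ hμ hμ0
    have hphase := norm_exp_I_mul_pencilPhase_le hpi μ ha'
    have hexp : Real.exp (-(a * μ.im)) * Real.exp (μ.im * a) = 1 := by
      rw [← Real.exp_add, Real.exp_eq_one_iff]
      ring
    calc _ ≤ ‖μ‖ * (K₀ * Real.exp (-(a * μ.im))) * (K * Real.exp (μ.im * a) / ‖μ‖ ^ 2) := by
          rw [norm_mul, norm_mul]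
          gcongr
      _ = K₀ * K / ‖μ‖ * (Real.exp (-(a * μ.im)) * Real.exp (μ.im * a)) := by field_simp
      _ = _ := by rw [hexp, mul_one]
  rw [← zero_div (Complex.I / 2 * c {⟨0, le_rfl, hT.le⟩})]
  refine (hnum.div hφθ hL).congr' ?_
  filter_upwards [hφθ.eventually_ne hL] with μ hμ
  rw [Pi.div_apply, div_eq_iff hμ]
  ring

theorem cauchyWronskian_eq_zero (hT : 0 < T) (hp : HasACDeriv T p p')
    (hq : IntervalIntegrable q volume 0 T) (hr : HasACDeriv T r r')
    (hs : IntervalIntegrable s volume 0 T) (hc : c {⟨0, le_rfl, hT.le⟩} ≠ 0) (ha : a ∈ Ioc 0 T)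
    (h : TransformsAgreeAt p q r s c a) (hx : x ∈ Icc (a / 2) a) (μ : ℂ) :
    cauchyWronskian T p q r s μ x a = 0 := by
  have hx0 : x ∈ Icc 0 a := ⟨by linarith [hx.1, ha.1], hx.2⟩
  have hbot := (tendsto_cauchyWronskian hT hp.neg hq hr.neg hs hc ha h.neg hx).comp
    tendsto_neg_comap_im_atBot
  simp only [Function.comp_def, cauchyWronskian_neg] at hbot
  exact IsExpType.eq_of_tendsto
    (differentiable_cauchyWronskian hT hp.ac.continuousOn.intervalIntegrable hq
      hr.ac.continuousOn.intervalIntegrable hs ⟨hx0.1, hx0.2.trans ha.2⟩ (Ioc_subset_Icc_self ha))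
    (isExpType_cauchyWronskian hT hp hq hr hs ha.2 hx0)
    (tendsto_cauchyWronskian hT hp hq hr hs hc ha h hx) hbot μ

end Halving

section Quotient

variable {𝕜 𝕜' : Type*} [NontriviallyNormedField 𝕜] [NormedField 𝕜'] [NormedAlgebra 𝕜 𝕜']
  {s : Set 𝕜} {a : 𝕜} {u u' v v' y y' z z' : 𝕜 → 𝕜'}

-- `y v' - z u'` is the factor `k` in `(y, z) = k (u, v)`, and it multiplies the Wronskian by `k²`.
theorem sq_eq_one_of_mul_eq_mul_of_wronskian_eq_one (hs : UniqueDiffOn 𝕜 s)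
    (hu : ∀ x ∈ s, HasDerivWithinAt u (u' x) s x) (hv : ∀ x ∈ s, HasDerivWithinAt v (v' x) s x)
    (hy : ∀ x ∈ s, HasDerivWithinAt y (y' x) s x) (hz : ∀ x ∈ s, HasDerivWithinAt z (z' x) s x)
    (huv : ∀ x ∈ s, u x * v' x - u' x * v x = 1) (hyz : ∀ x ∈ s, y x * z' x - y' x * z x = 1)
    (h : ∀ x ∈ s, u x * z x = v x * y x) {x : 𝕜} (hx : x ∈ s) :
    (y x * v' x - z x * u' x) ^ 2 = 1 := by
  have hderiv : u' x * z x + u x * z' x = v' x * y x + v x * y' x :=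
    (hs x hx).eq_deriv _ ((hu x hx).mul (hz x hx))
      (((hv x hx).mul (hy x hx)).congr h (h x hx))
  set k := y x * v' x - z x * u' x with hk
  have hyk : y x = u x * k := by linear_combination -y x * huv x hx + u' x * h x hx - u x * hk
  have hzk : z x = v x * k := by linear_combination -z x * huv x hx + v' x * h x hx - v x * hk
  have huk : u x * z' x - v x * y' x = k := by linear_combination hderiv - hk
  linear_combination hyz x hx - z' x * hyk + y' x * hzk - k * huk

theorem eqOn_of_mul_eq_mul_of_wronskian_eq_one (hs : UniqueDiffOn 𝕜 s) (hs' : IsPreconnected s)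
    (hu : ∀ x ∈ s, HasDerivWithinAt u (u' x) s x) (hv : ∀ x ∈ s, HasDerivWithinAt v (v' x) s x)
    (hy : ∀ x ∈ s, HasDerivWithinAt y (y' x) s x) (hz : ∀ x ∈ s, HasDerivWithinAt z (z' x) s x)
    (hu' : ContinuousOn u' s) (hv' : ContinuousOn v' s)
    (huv : ∀ x ∈ s, u x * v' x - u' x * v x = 1) (hyz : ∀ x ∈ s, y x * z' x - y' x * z x = 1)
    (h : ∀ x ∈ s, u x * z x = v x * y x) (ha : a ∈ s) (hya : y a = u a) (hza : z a = v a) :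
    EqOn y u s ∧ EqOn z v s := by
  have hk : EqOn (fun x => y x * v' x - z x * u' x) 1 s := by
    have hyc : ContinuousOn y s := fun x hx => (hy x hx).continuousWithinAt
    have hzc : ContinuousOn z s := fun x hx => (hz x hx).continuousWithinAt
    refine hs'.eq_of_sq_eq ((hyc.mul hv').sub (hzc.mul hu')) continuousOn_const (fun x hx => ?_)
      (fun _ => one_ne_zero) ha ?_
    · simpa using sq_eq_one_of_mul_eq_mul_of_wronskian_eq_one hs hu hv hy hz huv hyz h hx
    · simp only [hya, hza, Pi.one_apply]
      linear_combination huv a ha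
  constructor <;> intro x hx <;> have hkx : y x * v' x - z x * u' x = 1 := hk hx
  · linear_combination -y x * huv x hx + u' x * h x hx + u x * hkx
  · linear_combination -z x * huv x hx + v' x * h x hx + v x * hkx

end Quotient

section Coefficients

variable {T a b : ℝ} {p q r s : ℝ → ℂ} {μ : ℂ} {y y' z z' : ℝ → ℂ}

theorem PencilSolution.pencilCoeff_mul_ae_eq (hy : PencilSolution T p q μ y y')
    (hz : PencilSolution T r s μ z z') (hb : 0 ≤ b) (hba : b < a) (ha : a ≤ T)
    (h : EqOn y z (Icc b a)) :
    ∀ᵐ x ∂(volume.restrict (Ioo b a)),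
      pencilCoeff p q μ x * y x = pencilCoeff r s μ x * y x := by
  have hsub : Icc b a ⊆ Icc 0 T := Icc_subset_Icc hb ha
  have h' : EqOn y' z' (Icc b a) := fun x hx => (uniqueDiffOn_Icc hba x hx).eq_deriv _
    ((hy.hasDeriv x (hsub hx)).mono hsub)
    (((hz.hasDeriv x (hsub hx)).mono hsub).congr h (h hx))
  filter_upwards [ae_restrict_of_ae_restrict_of_subset (Ioo_subset_Ioo hb ha) hy.equation,
    ae_restrict_of_ae_restrict_of_subset (Ioo_subset_Ioo hb ha) hz.equation,
    ae_restrict_mem measurableSet_Ioo] with x hyx hzx hx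
  have hderiv := hyx.unique
    (hzx.congr_of_eventuallyEq (h'.eventuallyEq_of_mem (Icc_mem_nhds hx.1 hx.2)))
  rw [← h (Ioo_subset_Icc_self hx)] at hderiv
  simp only [pencilCoeff]
  linear_combination -hderiv

theorem cauchyKernel_wronskian (hT : 0 < T) (hp : IntervalIntegrable p volume 0 T)
    (hq : IntervalIntegrable q volume 0 T) (μ : ℂ) (ha : a ∈ Icc 0 T) {x : ℝ} (hx : x ∈ Icc 0 T) :
    cauchyKernelDeriv T p q μ x a * cauchyKernelDeriv T p q μ a x -
      cauchyKernelMixedDeriv T p q μ x a * cauchyKernel T p q μ a x = 1 := by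
  rw [(pencilSolution_cauchyKernelDeriv hT.le hp hq μ a).wronskian_eq hT hp hq
    (pencilSolution_cauchyKernel hT.le hp hq μ a) hx ha, cauchyKernelDeriv_self hT hp hq μ ha,
    cauchyKernel_self]
  ring

theorem cauchyKernel_eqOn_of_cauchyWronskian_eq_zero (hT : 0 < T)
    (hp : IntervalIntegrable p volume 0 T) (hq : IntervalIntegrable q volume 0 T)
    (hr : IntervalIntegrable r volume 0 T) (hs : IntervalIntegrable s volume 0 T)
    (hb : 0 ≤ b) (hba : b < a) (ha : a ≤ T)
    (h : ∀ x ∈ Icc b a, cauchyWronskian T p q r s μ x a = 0) :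
    EqOn (fun x => cauchyKernelDeriv T p q μ x a) (fun x => cauchyKernelDeriv T r s μ x a)
        (Icc b a) ∧
      EqOn (cauchyKernel T p q μ a) (cauchyKernel T r s μ a) (Icc b a) := by
  have hsub : Icc b a ⊆ Icc 0 T := Icc_subset_Icc hb ha
  have haI : a ∈ Icc b a := ⟨hba.le, le_rfl⟩
  have hU := pencilSolution_cauchyKernelDeriv hT.le hp hq μ a
  have hV := pencilSolution_cauchyKernel hT.le hp hq μ a
  have hY := pencilSolution_cauchyKernelDeriv hT.le hr hs μ a
  have hZ := pencilSolution_cauchyKernel hT.le hr hs μ a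
  refine (eqOn_of_mul_eq_mul_of_wronskian_eq_one (uniqueDiffOn_Icc hba) isPreconnected_Icc
    (fun x hx => (hY.hasDeriv x (hsub hx)).mono hsub)
    (fun x hx => (hZ.hasDeriv x (hsub hx)).mono hsub)
    (fun x hx => (hU.hasDeriv x (hsub hx)).mono hsub)
    (fun x hx => (hV.hasDeriv x (hsub hx)).mono hsub)
    ((hY.continuousOn_deriv hT).mono hsub) ((hZ.continuousOn_deriv hT).mono hsub)
    (fun x hx => cauchyKernel_wronskian hT hr hs μ (hsub haI) (hsub hx))
    (fun x hx => cauchyKernel_wronskian hT hp hq μ (hsub haI) (hsub hx)) (fun x hx => ?_) haI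
    ?_ ?_)
  · have hx := h x hx
    simp only [cauchyWronskian] at hx
    rw [cauchyKernel_swap μ a x, cauchyKernel_swap μ a x]
    linear_combination hx
  · simp only [cauchyKernelDeriv_self hT hp hq μ (hsub haI),
      cauchyKernelDeriv_self hT hr hs μ (hsub haI)]
  · simp only [cauchyKernel_self]

theorem pencilCoeff_ae_eq_of_cauchyWronskian_eq_zero (hT : 0 < T)
    (hp : IntervalIntegrable p volume 0 T) (hq : IntervalIntegrable q volume 0 T)
    (hr : IntervalIntegrable r volume 0 T) (hs : IntervalIntegrable s volume 0 T)
    (hb : 0 ≤ b) (hba : b < a) (ha : a ≤ T)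
    (h : ∀ x ∈ Icc b a, cauchyWronskian T p q r s μ x a = 0) :
    ∀ᵐ x ∂(volume.restrict (Ioo b a)), pencilCoeff p q μ x = pencilCoeff r s μ x := by
  obtain ⟨hKD, hK⟩ := cauchyKernel_eqOn_of_cauchyWronskian_eq_zero hT hp hq hr hs hb hba ha h
  filter_upwards [ae_restrict_mem measurableSet_Ioo,
    (pencilSolution_cauchyKernelDeriv hT.le hp hq μ a).pencilCoeff_mul_ae_eq
      (pencilSolution_cauchyKernelDeriv hT.le hr hs μ a) hb hba ha hKD,
    (pencilSolution_cauchyKernel hT.le hp hq μ a).pencilCoeff_mul_ae_eq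
      (pencilSolution_cauchyKernel hT.le hr hs μ a) hb hba ha hK] with x hx hU hV
  have hW := cauchyKernel_wronskian hT hp hq μ (a := a) ⟨hb.trans hba.le, ha⟩
    ⟨hb.trans hx.1.le, hx.2.le.trans ha⟩
  linear_combination (pencilCoeff r s μ x - pencilCoeff p q μ x) * hW +
    cauchyKernelDeriv T p q μ a x * hU - cauchyKernelMixedDeriv T p q μ x a * hV

end Coefficients

section Inverse

theorem ae_restrict_Ioo_of_forall_div_two_pow {T : ℝ} {P : ℝ → Prop}
    (h : ∀ n : ℕ, ∀ᵐ x ∂(volume.restrict (Ioo (T / 2 ^ n) T)), P x) :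
    ∀ᵐ x ∂(volume.restrict (Ioo 0 T)), P x := by
  refine ae_restrict_of_ae_restrict_of_subset (fun x hx => ?_) ((ae_restrict_iUnion_iff _ _).2 h)
  obtain ⟨n, hn⟩ := pow_unbounded_of_one_lt (T / x) one_lt_two
  refine mem_iUnion.2 ⟨n, ?_, hx.2⟩
  rw [div_lt_iff₀ (by positivity), mul_comm]
  rwa [div_lt_iff₀ hx.1] at hn

theorem ae_restrict_Ioo_of_ae_restrict_Ioo {b a T : ℝ} {P : ℝ → Prop}
    (hba : ∀ᵐ x ∂(volume.restrict (Ioo b a)), P x)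
    (haT : ∀ᵐ x ∂(volume.restrict (Ioo a T)), P x) :
    ∀ᵐ x ∂(volume.restrict (Ioo b T)), P x := by
  have hcover : Ioo b T ⊆ Ioc b a ∪ Ioo a T := fun x hx =>
    (le_or_gt x a).imp (fun hxa => ⟨hx.1, hxa⟩) fun hxa => ⟨hxa, hx.2⟩
  rw [Measure.restrict_congr_set Ioo_ae_eq_Ioc] at hba
  exact ae_restrict_of_ae_restrict_of_subset hcover ((ae_restrict_union_iff _ _ _).2 ⟨hba, haT⟩)

variable {T a : ℝ} {p p' q r r' s : ℝ → ℂ} {c : ComplexMeasure (Icc (0 : ℝ) T)}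

theorem TransformsAgreeAt.ae_eq_half (hT : 0 < T) (hp : HasACDeriv T p p')
    (hq : IntervalIntegrable q volume 0 T) (hr : HasACDeriv T r r')
    (hs : IntervalIntegrable s volume 0 T) (hc : c {⟨0, le_rfl, hT.le⟩} ≠ 0) (ha : a ∈ Ioc 0 T)
    (h : TransformsAgreeAt p q r s c a) :
    ∀ᵐ x ∂(volume.restrict (Ioo (a / 2) a)), p x = r x ∧ q x = s x := by
  have hcoeff (μ : ℂ) : ∀ᵐ x ∂(volume.restrict (Ioo (a / 2) a)),
      pencilCoeff p q μ x = pencilCoeff r s μ x :=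
    pencilCoeff_ae_eq_of_cauchyWronskian_eq_zero hT hp.ac.continuousOn.intervalIntegrable hq
      hr.ac.continuousOn.intervalIntegrable hs (half_pos ha.1).le (half_lt_self ha.1) ha.2
      fun x hx => cauchyWronskian_eq_zero hT hp hq hr hs hc ha h hx μ
  filter_upwards [hcoeff 0, hcoeff 1] with x h0 h1
  simp only [pencilCoeff] at h0 h1
  have hqs : q x = s x := by linear_combination -h0
  exact ⟨by linear_combination -h1 / 2 - hqs / 2, hqs⟩

theorem TransformsAgreeAt.ae_eq (hT : 0 < T) (hp : HasACDeriv T p p')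
    (hq : IntervalIntegrable q volume 0 T) (hr : HasACDeriv T r r')
    (hs : IntervalIntegrable s volume 0 T) (hc : c {⟨0, le_rfl, hT.le⟩} ≠ 0)
    (h : TransformsAgreeAt p q r s c T) :
    ∀ᵐ x ∂(volume.restrict (Ioo 0 T)), p x = r x ∧ q x = s x := by
  refine ae_restrict_Ioo_of_forall_div_two_pow fun n => ?_
  induction n with
  | zero => simp
  | succ n ih =>
    have ha : T / 2 ^ n ∈ Ioc 0 T := ⟨by positivity, div_le_self hT.le (one_le_pow₀ one_le_two)⟩
    have hhalf : T / 2 ^ (n + 1) = T / 2 ^ n / 2 := by rw [pow_succ, div_div]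
    have hagree : TransformsAgreeAt p q r s c (T / 2 ^ n) :=
      h.of_ae_eq hT hp.ac.continuousOn.intervalIntegrable hq
        hr.ac.continuousOn.intervalIntegrable hs (Ioc_subset_Icc_self ha)
        (ih.mono fun _ hx => hx.1) (ih.mono fun _ hx => hx.2)
    rw [hhalf]
    exact ae_restrict_Ioo_of_ae_restrict_Ioo (hagree.ae_eq_half hT hp hq hr hs hc ha) ih

theorem TransformsAgreeAt.of_spectrumMultiplicity_eq (hT : 0 < T) (hp : HasACDeriv T p p')
    (hq : IntervalIntegrable q volume 0 T) (hr : HasACDeriv T r r')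
    (hs : IntervalIntegrable s volume 0 T) (hc : c {⟨0, le_rfl, hT.le⟩} ≠ 0)
    (hint : ∫ x in (0 : ℝ)..T, p x = ∫ x in (0 : ℝ)..T, r x)
    (hspec : ∀ μ : ℂ, spectrumMultiplicity T p q (measureForm c) (fun Y => Y.1 T) μ =
      spectrumMultiplicity T r s (measureForm c) (fun Y => Y.1 T) μ)
    (hspec' : ∀ μ : ℂ, spectrumMultiplicity T p q (measureForm c) (fun Y => Y.2 T) μ =
      spectrumMultiplicity T r s (measureForm c) (fun Y => Y.2 T) μ) :
    TransformsAgreeAt p q r s c T := by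
  have hpi : IntervalIntegrable p volume 0 T := hp.ac.continuousOn.intervalIntegrable
  have hri : IntervalIntegrable r volume 0 T := hr.ac.continuousOn.intervalIntegrable
  simp only [spectrumMultiplicity_eval_eq c hT hpi hq,
    spectrumMultiplicity_eval_eq c hT hri hs] at hspec
  simp only [spectrumMultiplicity_eval_deriv_eq c hT hpi hq,
    spectrumMultiplicity_eval_deriv_eq c hT hri hs] at hspec'
  rw [← truncatedMeasure_self c] at hspec hspec'
  exact fun μ => ⟨
    congrFun (cauchyTransform_eq_of_analyticOrderAt_eq c hT hp hq hr hs hc ⟨hT, le_rfl⟩ hint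
      hspec) μ,
    congrFun (cauchyTransformDeriv_eq_of_analyticOrderAt_eq c hT hp hq hr hs hc ⟨hT, le_rfl⟩ hint
      hspec') μ⟩

end Inverse

theorem vectorMeasure_restrict_Icc_singleton_zero {T : ℝ} (hT : 0 < T) {σ : ℝ → ℂ}
    (hσ : BoundedVariationOn σ (Icc 0 T)) {H : ℂ}
    (hH : Tendsto (fun t => σ t - σ 0) (𝓝[>] 0) (𝓝 H)) :
    hσ.restrict_Icc.vectorMeasure {⟨0, le_rfl, hT.le⟩} = H := by
  set o : Icc (0 : ℝ) T := ⟨0, le_rfl, hT.le⟩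
  have hbot : IsBot o := fun x => x.2.1
  have : (𝓝[>] o).NeBot := nhdsGT_neBot_of_exists_gt ⟨⟨T, hT.le, le_rfl⟩, hT⟩
  have hcoe : Tendsto (fun t : Icc (0 : ℝ) T => (t : ℝ)) (𝓝[>] o) (𝓝[>] 0) :=
    tendsto_nhdsWithin_iff.2 ⟨(continuous_subtype_val.tendsto o).mono_left nhdsWithin_le_nhds,
      eventually_mem_nhdsWithin.mono fun _ ht => ht⟩
  have hlim : Tendsto ((Icc (0 : ℝ) T).domRestrict σ) (𝓝[>] o) (𝓝 (H + σ 0)) :=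
    ((hH.comp hcoe).add_const (σ 0)).congr fun t => by simp
  rw [BoundedVariationOn.vectorMeasure_singleton, leftLim_eq_of_isBot hbot,
    rightLim_eq_of_tendsto hlim]
  simp [o]

theorem theorem2_general (T : ℝ) (hT : 0 < T) (c : ComplexMeasure (Icc (0 : ℝ) T))
    (hc : c {⟨0, le_rfl, hT.le⟩} ≠ 0) (p₁ q₁ p₂ q₂ : ℝ → ℂ)
    (hp₁ : AbsolutelyContinuousOnInterval p₁ 0 T) (hq₁ : IntegrableOn q₁ (Ioo 0 T) volume)
    (hp₂ : AbsolutelyContinuousOnInterval p₂ 0 T) (hq₂ : IntegrableOn q₂ (Ioo 0 T) volume)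
    (hint : ∫ x in (0 : ℝ)..T, p₁ x = ∫ x in (0 : ℝ)..T, p₂ x)
    (hspec : ∀ μ : ℂ, spectrumMultiplicity T p₁ q₁ (measureForm c) (fun Y => Y.1 T) μ =
      spectrumMultiplicity T p₂ q₂ (measureForm c) (fun Y => Y.1 T) μ)
    (hspec' : ∀ μ : ℂ, spectrumMultiplicity T p₁ q₁ (measureForm c) (fun Y => Y.2 T) μ =
      spectrumMultiplicity T p₂ q₂ (measureForm c) (fun Y => Y.2 T) μ) :
    (∀ x ∈ Ioo 0 T, p₁ x = p₂ x) ∧ q₁ =ᵐ[volume.restrict (Ioo 0 T)] q₂ := by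
  obtain ⟨p₁', hp₁'⟩ := exists_hasACDeriv hp₁
  obtain ⟨p₂', hp₂'⟩ := exists_hasACDeriv hp₂
  have hqi₁ := (intervalIntegrable_iff_integrableOn_Ioo_of_le hT.le).2 hq₁
  have hqi₂ := (intervalIntegrable_iff_integrableOn_Ioo_of_le hT.le).2 hq₂
  have hae : ∀ᵐ x ∂(volume.restrict (Ioo 0 T)), p₁ x = p₂ x ∧ q₁ x = q₂ x :=
    (TransformsAgreeAt.of_spectrumMultiplicity_eq hT hp₁' hqi₁ hp₂' hqi₂ hc hint hspec
      hspec').ae_eq hT hp₁' hqi₁ hp₂' hqi₂ hc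
  exact ⟨Measure.eqOn_open_of_ae_eq (hae.mono fun _ h => h.1) isOpen_Ioo
    ((hp₁'.continuousOn hT).mono Ioo_subset_Icc_self)
    ((hp₂'.continuousOn hT).mono Ioo_subset_Icc_self), hae.mono fun _ h => h.2⟩

theorem theorem2 (T : ℝ) (hT : 0 < T)
    -- the function of bounded variation that defines the nonlocal condition
    (σ₁ : ℝ → ℂ) (hσ₁ : BoundedVariationOn σ₁ (Icc 0 T))
    (hσ₁_right : ∀ t ∈ Ioo 0 T, ContinuousWithinAt σ₁ (Ioi t) t)
    (H₁ : ℂ) (hH₁_lim : Tendsto (fun t => σ₁ t - σ₁ 0) (𝓝[>] 0) (𝓝 H₁)) (hH₁ : H₁ ≠ 0)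
    -- the two pairs of coefficients
    (p₁ q₁ p₂ q₂ : ℝ → ℂ)
    (hp₁ : AbsolutelyContinuousOnInterval p₁ 0 T) (hq₁ : IntegrableOn q₁ (Ioo 0 T) volume)
    (hp₂ : AbsolutelyContinuousOnInterval p₂ 0 T) (hq₂ : IntegrableOn q₂ (Ioo 0 T) volume)
    (hint : ∫ x in (0 : ℝ)..T, p₁ x = ∫ x in (0 : ℝ)..T, p₂ x)
    -- equal spectra of the problems with `U₁(y) = 0`, `y(T) = 0`
    (hspec₁ : ∀ μ : ℂ,
      spectrumMultiplicity T p₁ q₁ (stieltjesForm hσ₁) (fun Y => Y.1 T) μ =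
        spectrumMultiplicity T p₂ q₂ (stieltjesForm hσ₁) (fun Y => Y.1 T) μ)
    -- equal spectra of the problems with `U₁(y) = 0`, `y'(T) = 0`
    (hspec₁₁ : ∀ μ : ℂ,
      spectrumMultiplicity T p₁ q₁ (stieltjesForm hσ₁) (fun Y => Y.2 T) μ =
        spectrumMultiplicity T p₂ q₂ (stieltjesForm hσ₁) (fun Y => Y.2 T) μ) :
    (∀ x ∈ Ioo 0 T, p₁ x = p₂ x) ∧ q₁ =ᵐ[volume.restrict (Ioo 0 T)] q₂ := by
  exact theorem2_general T hT hσ₁.restrict_Icc.vectorMeasure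
    (vectorMeasure_restrict_Icc_singleton_zero hT hσ₁ hH₁_lim ▸ hH₁) p₁ q₁ p₂ q₂ hp₁ hq₁ hp₂ hq₂
    hint hspec₁ hspec₁₁
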